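/- Let $d\ge 3$ and $L\ge 1$ be integers, and let $H=H^*$ be a bounded selfadjoint operator on $\ell^2(\mathbb Z^d,\mathbb C^L)$ which is translation invariant: $\langle n+l|H|m+l\rangle=\langle n|H|m\rangle$ for all $n,m,l\in\mathbb Z^d$. Let $\mathcal F$ be the Fourier transform, $(\mathcal F\phi)(k)=(2\pi)^{-d/2}\sum_{n}e^{-\imath k\cdot n}\phi_n$, and suppose that $\mathcal F H\mathcal F^*$ is multiplication by a real-analytic matrix-valued function $k\in\mathbb T^d\mapsto\mathcal E(k)=\mathcal E(k)^*\in\mathbb C^{L\times L}$, where $\mathbb T^d=\mathbb R^d/2\pi\mathbb Z^d$. Assume: (i) there is no band touching, i.e. $\mathcal W=\{k\in\mathbb T^d:\mathcal E(k)\text{ has degenerate spectrum}\}$ is empty; (ii) all energy bands are Morse functions: whenever $U$ is open and $e:U\to\mathbb R$ is a real-analytic function such that $e(k)$ is an eigenvalue of $\mathcal E(k)$ for all $k\in U$, the Hessian $\nabla^2e(k^*)$ is non-degenerate at every $k^*\in U$ with $\nabla e(k^*)=0$ (no restriction on its signature). For $\alpha\ge 0$ and $z\in\mathbb C\setminus\mathbb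 R$ let $$\mathcal R^z_\alpha=\langle X\rangle^{-\alpha}(H-z\mathbf 1)^{-1}\langle X\rangle^{-\alpha},\qquad (\langle X\rangle^{-\alpha}\phi)_n=(1+|n|^2)^{-\alpha/2}\phi_n ,$$ with $|n|$ the Euclidean length. Let $\alpha>\frac{d+2}{4}$. Then, for each of the two signs $\pm$: (a) for every $E\in\mathbb R$ the limit $\mathcal R^{E\pm\imath0}_\alpha=\lim_{\epsilon\downarrow0}\mathcal R^{E\pm\imath\epsilon}_\alpha$ exists in operator norm; (b) for every $\beta>0$ with $\beta<\min\{2\alpha-\frac{d+2}{2},\frac{d-2}{2},\alpha-1,1\}$ there is a constant $C_\beta$ such that $$\|\mathcal R^{E\pm\imath0}_\alpha-\mathcal R^{E'\pm\imath0}_\alpha\|\le C_\beta\,|E-E'|^\beta\qquad\text{for all }E,E'\in\mathbb R .$$ -/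

import Mathlib

open Filter Topology
open scoped NNReal

noncomputable section

namespace BlochLAP

/-- The fibre `ℂ^L` with its Euclidean norm. -/
abbrev Fibre (L : ℕ) : Type := EuclideanSpace ℂ (Fin L)

/-- The Hilbert space `ℓ²(ℤ^d, ℂ^L)`. -/
abbrev Hilb (d L : ℕ) : Type := lp (fun _ : Fin d → ℤ => Fibre L) 2

/-- Bounded operators on `ℓ²(ℤ^d, ℂ^L)`, with the operator norm. -/
abbrev Op (d L : ℕ) : Type := Hilb d L →L[ℂ] Hilb d L

/-- Quasimomentum space. The torus `𝕋^d` is `ℝ^d` modulo `2πℤ^d`; functions on the torus are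
given by their periodic lifts. -/
abbrev Momentum (d : ℕ) : Type := EuclideanSpace ℝ (Fin d)

variable {d L : ℕ}

/-- The matrix element `⟨n|H|m⟩ : ℂ^L → ℂ^L`. -/
def matrixElement (H : Op d L) (n m : Fin d → ℤ) (v : Fibre L) : Fibre L :=
  H (lp.single 2 m v) n

/-- `⟨n+l|H|m+l⟩ = ⟨n|H|m⟩` for all sites `n, m, l`. -/
def TranslationInvariant (H : Op d L) : Prop :=
  ∀ n m l : Fin d → ℤ, matrixElement H (n + l) (m + l) = matrixElement H n m

/-- `f` is the Fourier transform `f(k) = (2π)^{-d/2} ∑ₙ e^{-i k·n} φₙ` of `φ`, the series being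
(absolutely) convergent at every `k`; such an `f` exists exactly when `φ ∈ ℓ¹(ℤ^d, ℂ^L)`. -/
def HasFourierTransform (φ : Hilb d L) (f : Momentum d → Fibre L) : Prop :=
  ∀ k : Momentum d,
    HasSum (fun n : Fin d → ℤ =>
      ((((2 * Real.pi) ^ (-(d : ℝ) / 2) : ℝ) : ℂ) *
        Complex.exp (-Complex.I * ((∑ i, k i * (n i : ℝ) : ℝ) : ℂ))) • φ n) (f k)

/-- The matrix-valued function `ℰ` is the symbol of `H`: the Fourier transform `F` turns `H` into
multiplication by `ℰ`, that is `(F H φ)(k) = ℰ(k) (F φ)(k)` for all `φ` in the dense subspace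
`ℓ¹(ℤ^d, ℂ^L)`, on which `F` is given by its series. -/
def IsSymbol (H : Op d L) (ℰ : Momentum d → Matrix (Fin L) (Fin L) ℂ) : Prop :=
  ∀ (φ : Hilb d L) (f : Momentum d → Fibre L),
    HasFourierTransform φ f →
      HasFourierTransform (H φ) (fun k => Matrix.toEuclideanCLM (𝕜 := ℂ) (ℰ k) (f k))

/-- Real analyticity of a matrix-valued function, entry by entry. -/
def IsAnalyticSymbol (ℰ : Momentum d → Matrix (Fin L) (Fin L) ℂ) : Prop :=
  ∀ i j : Fin L, AnalyticOnNhd ℝ (fun k => ℰ k i j) Set.univ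

/-- The (periodic) set `𝒲` of all `k` such that `ℰ(k)` has degenerate spectrum, i.e. some
eigenvalue has at least two linearly independent eigenvectors. -/
def degeneracySet (ℰ : Momentum d → Matrix (Fin L) (Fin L) ℂ) : Set (Momentum d) :=
  {k | ∃ μ : ℂ, 2 ≤ Module.finrank ℂ (Module.End.eigenspace (Matrix.toLin' (ℰ k)) μ)}

/-- `e` is an energy band of `ℰ` over the open set `U`: a real-analytic real function on `U` whose
value at each `k ∈ U` is an eigenvalue of `ℰ(k)`. -/
def IsBandOn (ℰ : Momentum d → Matrix (Fin L) (Fin L) ℂ) (U : Set (Momentum d))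
    (e : Momentum d → ℝ) : Prop :=
  AnalyticOnNhd ℝ e U ∧
    ∀ k ∈ U, Module.End.HasEigenvalue (Matrix.toLin' (ℰ k)) ((e k : ℝ) : ℂ)

/-- The Hessian of `e` at `k`, as the derivative of the gradient. -/
def hessian (e : Momentum d → ℝ) (k : Momentum d) : Momentum d →L[ℝ] Momentum d :=
  fderiv ℝ (gradient e) k

/-- Every critical point of `e` in `U` has a non-degenerate Hessian. -/
def IsMorseOn (e : Momentum d → ℝ) (U : Set (Momentum d)) : Prop :=
  ∀ k ∈ U, gradient e k = 0 → (hessian e k).det ≠ 0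

/-- Away from the degeneracy set, all energy bands are Morse functions. -/
def AllBandsMorse (ℰ : Momentum d → Matrix (Fin L) (Fin L) ℂ) : Prop :=
  ∀ (U : Set (Momentum d)) (e : Momentum d → ℝ),
    IsOpen U → Disjoint U (degeneracySet ℰ) → IsBandOn ℰ U e → IsMorseOn e U

/-- `⟨n⟩^{-α} = (1 + |n|²)^{-α/2}`, with `|n|` the Euclidean length. -/
def weight (α : ℝ≥0) (n : Fin d → ℤ) : ℝ :=
  (1 + ∑ i, (n i : ℝ) ^ 2) ^ (-(α : ℝ) / 2)

lemma weight_nonneg (α : ℝ≥0) (n : Fin d → ℤ) : 0 ≤ weight α n := by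
  unfold weight
  positivity

lemma weight_le_one (α : ℝ≥0) (n : Fin d → ℤ) : weight α n ≤ 1 := by
  unfold weight
  apply Real.rpow_le_one_of_one_le_of_nonpos
  · have : 0 ≤ ∑ i, (n i : ℝ) ^ 2 := by positivity
    linarith
  · have : (0 : ℝ) ≤ α := α.2
    linarith

lemma norm_weight_smul_le (α : ℝ≥0) (φ : Hilb d L) (n : Fin d → ℤ) :
    ‖((weight α n : ℝ) : ℂ) • φ n‖ ≤ ‖φ n‖ := by
  rw [norm_smul, Complex.norm_real, Real.norm_of_nonneg (weight_nonneg α n)]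
  exact mul_le_of_le_one_left (norm_nonneg _) (weight_le_one α n)

/-- The bounded multiplication operator `⟨X⟩^{-α}`, `(⟨X⟩^{-α} φ)ₙ = ⟨n⟩^{-α} φₙ`, for `α ≥ 0`. -/
def weightOp (d L : ℕ) (α : ℝ≥0) : Op d L :=
  LinearMap.mkContinuous
    { toFun := fun φ =>
        (⟨fun n => ((weight α n : ℝ) : ℂ) • φ n,
          (lp.memℓp φ).mono' (norm_weight_smul_le α φ)⟩ : Hilb d L)
      map_add' := fun φ ψ => by
        ext1
        funext n
        exact smul_add _ _ _
      map_smul' := fun c φ => by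
        ext1
        funext n
        exact smul_comm ((weight α n : ℝ) : ℂ) c (φ n) }
    1 (fun φ => by
      rw [one_mul]
      exact lp.norm_mono (by norm_num) (norm_weight_smul_le α φ))

lemma weightOp_apply (α : ℝ≥0) (φ : Hilb d L) (n : Fin d → ℤ) :
    weightOp d L α φ n = ((weight α n : ℝ) : ℂ) • φ n := rfl

/-- The resolvent `R^z = (H - z)⁻¹`, for `z` outside the spectrum of `H`. -/
def resolventOp (H : Op d L) (z : ℂ) : Op d L :=
  Ring.inverse (H - z • (1 : Op d L))

/-- The damped resolvent `⟨X⟩^{-α} R^z ⟨X⟩^{-α}`. -/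
def dampedResolvent (H : Op d L) (α : ℝ≥0) (z : ℂ) : Op d L :=
  weightOp d L α * resolventOp H z * weightOp d L α

end BlochLAP

end

/-! ### The torus: fundamental cell, periodic functions, integrals of derivatives. -/

noncomputable section

namespace BlochLAP

open MeasureTheory Set
open scoped ContDiff

variable {d L : ℕ}

/-! In the upper half plane the resolvent at `z` is the Laplace transform `i ∫₀^∞ e^{itz} e^{-itH}
dt`, so the matter reduces to decay in norm of `⟨X⟩^{-α} e^{-itH} ⟨X⟩^{-α}`
(`exists_norm_weightOp_propagator_le`). If this is `O((1+t)^{-γ})` with `γ > 1`, dominated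
convergence gives the boundary values, and `|e^{itE} - e^{itE'}| ≤ 2 (t|E - E'|)^β` makes them
`β`-Hölder for `β ≤ 1`, `β < γ - 1`. Every `γ` in `[0, min(d/2, 2α - d/2))` is available; some such
`γ` exceeds `1` because `d ≥ 3` and `α > (d+2)/4`. The lower half plane follows by taking adjoints.

The decay is obtained by cutting the weights at radius of order `t`. Between sites with `|n - n'| ≤
ct` the kernel of `e^{-itH}` is `O(t^{-d/2})` and a Hilbert–Schmidt estimate applies
(`norm_diagOp_mul_mul_diagOp_le`); otherwise one weight is already `O(t^{-α})` and unitarity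
suffices.

For the kernel: without band touching the sorted eigenvalues are global analytic periodic functions
with smooth spectral projections (`exists_bands`), so the kernel is a finite sum of oscillatory
integrals with phase `t(λ(k) - k·v)`, `v = (n - n')/t`. Stationary phase uniform in small `v`
(`exists_norm_integral_cell_le_of_morse`) needs no normal form. With `g = (1 + t|∇λ - v|²)⁻¹`, the
operator `g(1 + i(∇λ - v)·∇)` fixes the oscillating factor, and each use of its transpose gains a
factor `g`; the integral is thus bounded by `∫ g^{d+1}`. Away from critical points `g = O(1/t)`.
Near one, the invertible Hessian makes `y = ∇λ(k)` a change of variables, and `∫ (1 + t|y -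
v|²)^{-d-1} dy = O(t^{-d/2})`. The signature of the Hessian plays no role. -/

/-- The vector `2πn` of the period lattice. -/
def period (n : Fin d → ℤ) : Momentum d := WithLp.toLp 2 fun i => 2 * Real.pi * (n i : ℝ)

@[simp] lemma period_apply (n : Fin d → ℤ) (i : Fin d) : period n i = 2 * Real.pi * (n i : ℝ) := rfl

/-- Functions on momentum space that descend to the torus. -/
def IsPeriodic {F : Type*} (f : Momentum d → F) : Prop :=
  ∀ (n : Fin d → ℤ) (k : Momentum d), f (k + period n) = f k

/-- The standard coordinate vectors. -/
abbrev coordVec (j : Fin d) : Momentum d := EuclideanSpace.single j (1 : ℝ)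

/-- The partial derivative along the `j`-th coordinate. -/
def pderiv {F : Type*} [NormedAddCommGroup F] [NormedSpace ℝ F] (j : Fin d) (f : Momentum d → F)
    (k : Momentum d) : F :=
  fderiv ℝ f k (coordVec j)

/-- The closed fundamental cell `[0, 2π]^d`. -/
def cell (d : ℕ) : Set (Momentum d) := {k | ∀ i, k i ∈ Icc 0 (2 * Real.pi)}

lemma cell_eq_image :
    cell d = WithLp.toLp 2 '' Icc (0 : Fin d → ℝ) (fun _ => 2 * Real.pi) := by
  ext k
  constructor
  · intro h
    exact ⟨WithLp.ofLp k, ⟨fun i => (h i).1, fun i => (h i).2⟩, rfl⟩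
  · rintro ⟨x, hx, rfl⟩ i
    exact ⟨hx.1 i, hx.2 i⟩

lemma isCompact_cell : IsCompact (cell d) := by
  rw [cell_eq_image]
  exact isCompact_Icc.image (PiLp.continuous_toLp 2 _)

lemma measurableSet_cell : MeasurableSet (cell d) := isCompact_cell.isClosed.measurableSet

lemma setIntegral_cell {F : Type*} [NormedAddCommGroup F] [NormedSpace ℝ F]
    (f : Momentum d → F) :
    ∫ k in cell d, f k = ∫ x in Icc (0 : Fin d → ℝ) (fun _ => 2 * Real.pi), f (WithLp.toLp 2 x) := by
  rw [← (PiLp.volume_preserving_toLp (Fin d)).setIntegral_preimage_emb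
    (MeasurableEquiv.toLp 2 (Fin d → ℝ)).measurableEmbedding f (cell d)]
  congr 2
  ext x
  exact ⟨fun h => ⟨fun i => (h i).1, fun i => (h i).2⟩, fun h i => ⟨h.1 i, h.2 i⟩⟩

lemma Continuous.integrableOn_cell {F : Type*} [NormedAddCommGroup F] {f : Momentum d → F}
    (hf : Continuous f) : IntegrableOn f (cell d) :=
  hf.continuousOn.integrableOn_compact isCompact_cell

lemma IsPeriodic.exists_mem_cell {F : Type*} {f : Momentum d → F} (hf : IsPeriodic f)
    (k : Momentum d) : ∃ k' ∈ cell d, f k' = f k := by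
  refine ⟨k + period (fun i => -⌊k i / (2 * Real.pi)⌋), fun i => ?_, hf _ _⟩
  have hpi := Real.two_pi_pos
  have h1 := Int.floor_le (k i / (2 * Real.pi))
  have h2 := (Int.lt_floor_add_one (k i / (2 * Real.pi))).le
  rw [le_div_iff₀ hpi] at h1
  rw [div_le_iff₀ hpi] at h2
  simp only [PiLp.add_apply, period_apply, Int.cast_neg]
  constructor <;> nlinarith

lemma IsPeriodic.exists_bound {F : Type*} [NormedAddCommGroup F] {f : Momentum d → F}
    (hf : IsPeriodic f) (hc : Continuous f) : ∃ C, ∀ k, ‖f k‖ ≤ C := by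
  obtain ⟨C, hC⟩ := isCompact_cell.exists_bound_of_continuousOn hc.continuousOn
  refine ⟨C, fun k => ?_⟩
  obtain ⟨k', hk', h⟩ := hf.exists_mem_cell k
  exact h ▸ hC k' hk'

/-- The integral of a partial derivative over the torus vanishes. -/
lemma integral_cell_pderiv_eq_zero {f : Momentum d → ℂ} (hf : ContDiff ℝ 1 f)
    (hper : IsPeriodic f) (j : Fin d) : ∫ k in cell d, pderiv j f k = 0 := by
  rw [setIntegral_cell]
  obtain _ | n := d
  · exact j.elim0
  let φ : (Fin (n + 1) → ℝ) →L[ℝ] Momentum (n + 1) :=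
    ((PiLp.continuousLinearEquiv 2 ℝ fun _ : Fin (n + 1) => ℝ).symm :
      (Fin (n + 1) → ℝ) →L[ℝ] Momentum (n + 1))
  have hd : ∀ x, HasFDerivAt (fun y => f (φ y)) ((fderiv ℝ f (φ x)).comp φ) x := fun x =>
    ((hf.differentiable one_ne_zero) _).hasFDerivAt.comp x φ.hasFDerivAt
  have key := integral_divergence_of_hasFDerivAt_off_countable' (E := ℂ)
    (0 : Fin (n + 1) → ℝ) (fun _ => 2 * Real.pi) (fun _ => Real.two_pi_pos.le)
    (fun i x => if i = j then f (φ x) else 0)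
    (fun i x => if i = j then (fderiv ℝ f (φ x)).comp φ else 0) ∅ countable_empty ?_ ?_ ?_
  · have e1 : ∀ x : Fin (n + 1) → ℝ, pderiv j f (WithLp.toLp 2 x) =
        ∑ i, (if i = j then (fderiv ℝ f (φ x)).comp φ else 0) (Pi.single i 1) := by
      intro x
      rw [Finset.sum_eq_single j]
      · simp only [if_true]
        rfl
      · intro b _ hb
        simp [hb]
      · simp
    simp_rw [e1]
    rw [key]
    refine Finset.sum_eq_zero fun i _ => ?_
    by_cases hij : i = j
    · simp only [hij, if_true]
      rw [sub_eq_zero]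
      refine integral_congr_ae (Eventually.of_forall fun x => ?_)
      simp only [Pi.zero_apply]
      -- The period in direction `j` carries the face `k_j = 0` to the opposite face `k_j = 2π`, so
      -- the two boundary terms cancel.
      rw [← hper (Pi.single j 1) (φ (Fin.insertNth j 0 x))]
      congr 1
      ext i
      change (Fin.insertNth j (2 * Real.pi) x : Fin (n + 1) → ℝ) i =
        (Fin.insertNth j 0 x : Fin (n + 1) → ℝ) i + 2 * Real.pi * ((Pi.single j 1 : Fin (n+1) → ℤ) i : ℝ)
      refine Fin.succAboveCases j ?_ (fun l => ?_) i
      · simp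
      · simp [Fin.succAbove_ne]
    · simp [hij]
  · intro i
    by_cases h : i = j
    · simp only [h, if_true]
      exact (hf.continuous.comp φ.continuous).continuousOn
    · simp only [h, if_false]
      exact continuousOn_const
  · intro x _ i
    by_cases h : i = j
    · simp only [h, if_true]
      exact hd x
    · simp only [h, if_false]
      exact hasFDerivAt_const _ _
  · refine Continuous.integrableOn_Icc ?_
    refine continuous_finsetSum _ fun i _ => ?_
    by_cases h : i = j
    · simp only [h, if_true]
      exact (((hf.continuous_fderiv one_ne_zero).comp φ.continuous).clm_comp
        continuous_const).clm_apply continuous_const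
    · simp only [h, if_false]
      exact continuous_const

/-- Smooth periodic functions. -/
structure IsTorusSmooth {F : Type*} [NormedAddCommGroup F] [NormedSpace ℝ F]
    (f : Momentum d → F) : Prop where
  smooth : ContDiff ℝ ∞ f
  periodic : IsPeriodic f

namespace IsTorusSmooth

variable {F : Type*} [NormedAddCommGroup F] [NormedSpace ℝ F]

lemma exists_bound {f : Momentum d → F} (hf : IsTorusSmooth f) : ∃ C, ∀ k, ‖f k‖ ≤ C :=
  hf.periodic.exists_bound hf.smooth.continuous

lemma pderiv {f : Momentum d → F} (hf : IsTorusSmooth f) (j : Fin d) :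
    IsTorusSmooth (pderiv j f) where
  smooth := (hf.smooth.fderiv_right (m := ∞) (by norm_cast)).clm_apply contDiff_const
  periodic n k := by
    have h : f = fun x => f (x + period n) := by
      funext x
      exact (hf.periodic n x).symm
    unfold BlochLAP.pderiv
    conv_rhs => rw [h]
    rw [fderiv_comp_add_right]

lemma const (c : F) : IsTorusSmooth (fun _ : Momentum d => c) :=
  ⟨contDiff_const, fun _ _ => rfl⟩

lemma sum {ι : Type*} (s : Finset ι) {f : ι → Momentum d → F} (hf : ∀ i ∈ s, IsTorusSmooth (f i)) :
    IsTorusSmooth (fun k => ∑ i ∈ s, f i k) :=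
  ⟨ContDiff.sum fun i hi => (hf i hi).smooth,
    fun n k => Finset.sum_congr rfl fun i hi => (hf i hi).periodic n k⟩

lemma ofReal {f : Momentum d → ℝ} (hf : IsTorusSmooth f) :
    IsTorusSmooth (fun k => (f k : ℂ)) :=
  ⟨Complex.ofRealCLM.contDiff.comp hf.smooth, fun n k => by simp only [hf.periodic n k]⟩

lemma add {f g : Momentum d → F} (hf : IsTorusSmooth f) (hg : IsTorusSmooth g) :
    IsTorusSmooth (fun k => f k + g k) :=
  ⟨hf.smooth.add hg.smooth, fun n k => by simp only [hf.periodic n k, hg.periodic n k]⟩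

lemma mul {f g : Momentum d → ℂ} (hf : IsTorusSmooth f) (hg : IsTorusSmooth g) :
    IsTorusSmooth (fun k => f k * g k) :=
  ⟨hf.smooth.mul hg.smooth, fun n k => by simp only [hf.periodic n k, hg.periodic n k]⟩

end IsTorusSmooth

end BlochLAP

end

/-! ### Integration by parts along the vector field `∇λ - v`. -/

noncomputable section

namespace BlochLAP

open MeasureTheory Set
open scoped ContDiff

variable {d L : ℕ}

section Pderiv

variable {j : Fin d} {k : Momentum d}

lemma pderiv_add {F : Type*} [NormedAddCommGroup F] [NormedSpace ℝ F] {f g : Momentum d → F}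
    (hf : DifferentiableAt ℝ f k) (hg : DifferentiableAt ℝ g k) :
    pderiv j (fun x => f x + g x) k = pderiv j f k + pderiv j g k := by
  simp only [pderiv]
  rw [fderiv_fun_add hf hg]
  rfl

lemma pderiv_mul {𝕜 : Type*} [NormedField 𝕜] [NormedAlgebra ℝ 𝕜] {f g : Momentum d → 𝕜}
    (hf : DifferentiableAt ℝ f k) (hg : DifferentiableAt ℝ g k) :
    pderiv j (fun x => f x * g x) k = pderiv j f k * g k + f k * pderiv j g k := by
  simp only [pderiv]
  rw [fderiv_fun_mul hf hg]
  simp only [_root_.add_apply, _root_.smul_apply, smul_eq_mul]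
  ring

lemma pderiv_ofReal {f : Momentum d → ℝ} (hf : DifferentiableAt ℝ f k) :
    pderiv j (fun x => (f x : ℂ)) k = ((pderiv j f k : ℝ) : ℂ) := by
  simp only [pderiv]
  have h : HasFDerivAt (fun x => (f x : ℂ)) (Complex.ofRealCLM.comp (fderiv ℝ f k)) k :=
    Complex.ofRealCLM.hasFDerivAt.comp k hf.hasFDerivAt
  rw [h.fderiv]
  rfl

end Pderiv

/-- The `j`-th component of `∇λ(k) - v`. -/
def slope (lam : Momentum d → ℝ) (v : Momentum d) (j : Fin d) (k : Momentum d) : ℝ :=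
  pderiv j lam k - v j

/-- The function `(1 + t|∇λ(k) - v|²)⁻¹`. -/
def gain (lam : Momentum d → ℝ) (t : ℝ) (v k : Momentum d) : ℝ :=
  (1 + t * ∑ j, slope lam v j k ^ 2)⁻¹

/-- The derivative along the vector field `∇λ - v`. -/
def drift (lam : Momentum d → ℝ) (v : Momentum d) (F : Momentum d → ℂ) (k : Momentum d) : ℂ :=
  ∑ j, (slope lam v j k : ℂ) * pderiv j F k

/-- The mixed second partial derivatives. -/
def hess (lam : Momentum d → ℝ) (j l : Fin d) : Momentum d → ℝ := pderiv j (pderiv l lam)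

section Slope

variable {lam : Momentum d → ℝ} {t : ℝ} {v k : Momentum d}

lemma gain_den_pos (ht : 0 < t) : 0 < 1 + t * ∑ j, slope lam v j k ^ 2 := by positivity

lemma gain_pos (ht : 0 < t) : 0 < gain lam t v k := inv_pos.2 (gain_den_pos ht)

lemma isTorusSmooth_slope (hlam : IsTorusSmooth lam) (v : Momentum d) (j : Fin d) :
    IsTorusSmooth (slope lam v j) := by
  simpa only [slope, sub_eq_add_neg] using! (hlam.pderiv j).add (IsTorusSmooth.const (-(v j)))

lemma isTorusSmooth_gain (hlam : IsTorusSmooth lam) (ht : 0 < t) (v : Momentum d) :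
    IsTorusSmooth (gain lam t v) where
  smooth := by
    refine ContDiff.inv ?_ fun k => (gain_den_pos ht).ne'
    exact contDiff_const.add (contDiff_const.mul
      (ContDiff.sum fun j _ => (isTorusSmooth_slope hlam v j).smooth.pow 2))
  periodic n k := by
    simp only [gain, (isTorusSmooth_slope hlam v _).periodic n k]

lemma isTorusSmooth_hess (hlam : IsTorusSmooth lam) (j l : Fin d) :
    IsTorusSmooth (hess lam j l) := (hlam.pderiv l).pderiv j

lemma pderiv_slope (j l : Fin d) :
    pderiv j (slope lam v l) k = hess lam j l k := by
  change fderiv ℝ (fun k => pderiv l lam k - v l) k _ = _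
  rw [fderiv_sub_const]
  rfl

lemma pderiv_gain (hlam : IsTorusSmooth lam) (ht : 0 < t) (j : Fin d) :
    pderiv j (gain lam t v) k =
      ∑ l, -2 * (t * slope lam v l k * gain lam t v k) * gain lam t v k * hess lam j l k := by
  have hs : ∀ l, HasFDerivAt (slope lam v l) (fderiv ℝ (slope lam v l) k) k := fun l =>
    ((isTorusSmooth_slope hlam v l).smooth.differentiable (by norm_num) k).hasFDerivAt
  have h := (HasFDerivAt.const_add 1 ((HasFDerivAt.fun_sum (u := Finset.univ)
    fun l _ => (hs l).pow 2).const_mul t))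
  have h2 := (hasDerivAt_inv
    (gain_den_pos (lam := lam) (v := v) (k := k) ht).ne').comp_hasFDerivAt k h
  have h3 : pderiv j (gain lam t v) k = _ := congrArg (fun f => f (coordVec j)) h2.fderiv
  have h4 : ((1 + t * ∑ j, slope lam v j k ^ 2) ^ 2)⁻¹ = gain lam t v k ^ 2 := (inv_pow _ _).symm
  rw [h3, h4]
  simp only [_root_.smul_apply, _root_.sum_apply, smul_eq_mul,
    Finset.mul_sum, nsmul_eq_mul]
  refine Finset.sum_congr rfl fun l _ => ?_
  have h5 : fderiv ℝ (slope lam v l) k (coordVec j) = hess lam j l k := pderiv_slope j l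
  rw [h5]
  push_cast
  ring

/-- Since `t|∇λ - v|² * gain ≤ 1`, differentiating `gain` along `∇λ - v` costs no power of `t`,
unlike differentiating it in a fixed direction. -/
lemma abs_mul_slope_mul_gain_le (ht : 0 < t) (j l : Fin d) :
    |t * slope lam v j k * slope lam v l k * gain lam t v k| ≤ 1 := by
  have hle : ∀ i, slope lam v i k ^ 2 ≤ ∑ j, slope lam v j k ^ 2 := fun i =>
    Finset.single_le_sum (f := fun j => slope lam v j k ^ 2) (fun i _ => sq_nonneg _)
      (Finset.mem_univ i)
  have hjl : |slope lam v j k * slope lam v l k| ≤ ∑ j, slope lam v j k ^ 2 := by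
    rw [abs_le]
    constructor <;>
      nlinarith [hle j, hle l, sq_nonneg (slope lam v j k + slope lam v l k),
        sq_nonneg (slope lam v j k - slope lam v l k)]
  rw [mul_assoc t, abs_mul, abs_mul, abs_of_pos ht, abs_of_pos (gain_pos ht), gain,
    ← div_eq_mul_inv, div_le_one (gain_den_pos ht)]
  nlinarith

end Slope

section Drift

variable {lam : Momentum d → ℝ} {v k : Momentum d}

lemma drift_add {F G : Momentum d → ℂ} (hF : DifferentiableAt ℝ F k)
    (hG : DifferentiableAt ℝ G k) :
    drift lam v (fun x => F x + G x) k = drift lam v F k + drift lam v G k := by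
  simp only [drift, pderiv_add hF hG, mul_add, Finset.sum_add_distrib]

lemma drift_mul {F G : Momentum d → ℂ} (hF : DifferentiableAt ℝ F k)
    (hG : DifferentiableAt ℝ G k) :
    drift lam v (fun x => F x * G x) k = drift lam v F k * G k + F k * drift lam v G k := by
  simp only [drift, pderiv_mul hF hG, Finset.mul_sum, Finset.sum_mul, ← Finset.sum_add_distrib]
  exact Finset.sum_congr rfl fun _ _ => by ring

end Drift

/-- Amplitudes of order `N`: they are smooth and periodic in `k`, bounded by a multiple of
`gain ^ N`, and stable under `drift`. -/
inductive SymbolClass (lam : Momentum d → ℝ) :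
    ℕ → (ℝ → Momentum d → Momentum d → ℂ) → Prop
  | zero (N : ℕ) : SymbolClass lam N fun _ _ _ => 0
  | base {b : Momentum d → ℂ} (hb : IsTorusSmooth b) : SymbolClass lam 0 fun _ _ k => b k
  | slope (j : Fin d) : SymbolClass lam 0 fun _ v k => (slope lam v j k : ℂ)
  | gain : SymbolClass lam 1 fun t v k => (gain lam t v k : ℂ)
  | quad (j l : Fin d) : SymbolClass lam 0 fun t v k =>
      ((t * BlochLAP.slope lam v j k * BlochLAP.slope lam v l k * BlochLAP.gain lam t v k : ℝ) : ℂ)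
  | add {N : ℕ} {F G : ℝ → Momentum d → Momentum d → ℂ} (hF : SymbolClass lam N F)
      (hG : SymbolClass lam N G) : SymbolClass lam N fun t v k => F t v k + G t v k
  | mul {N M : ℕ} {F G : ℝ → Momentum d → Momentum d → ℂ} (hF : SymbolClass lam N F)
      (hG : SymbolClass lam M G) : SymbolClass lam (N + M) fun t v k => F t v k * G t v k

namespace SymbolClass

variable {lam : Momentum d → ℝ} {N : ℕ} {F : ℝ → Momentum d → Momentum d → ℂ}

lemma sum {ι : Type*} (s : Finset ι) {F : ι → ℝ → Momentum d → Momentum d → ℂ}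
    (hF : ∀ i, SymbolClass lam N (F i)) :
    SymbolClass lam N fun t v k => ∑ i ∈ s, F i t v k := by
  classical
  induction s using Finset.induction_on with
  | empty => simpa using zero N
  | insert a s ha ih =>
    simp only [Finset.sum_insert ha]
    exact (hF a).add ih

lemma const_mul (c : ℂ) (hF : SymbolClass lam N F) :
    SymbolClass lam N fun t v k => c * F t v k := by
  simpa using (base (IsTorusSmooth.const c)).mul hF

lemma base_mul {b : Momentum d → ℂ} (hb : IsTorusSmooth b) (hF : SymbolClass lam N F) :
    SymbolClass lam N fun t v k => b k * F t v k := by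
  simpa using (base hb).mul hF

lemma isTorusSmooth (hlam : IsTorusSmooth lam) (hF : SymbolClass lam N F) {t : ℝ} (ht : 0 < t)
    (v : Momentum d) : IsTorusSmooth (F t v) := by
  induction hF with
  | zero N => exact IsTorusSmooth.const 0
  | base hb => exact hb
  | slope j => exact (isTorusSmooth_slope hlam v j).ofReal
  | gain => exact (isTorusSmooth_gain hlam ht v).ofReal
  | quad j l =>
    simp only [Complex.ofReal_mul]
    exact (((IsTorusSmooth.const _).mul (isTorusSmooth_slope hlam v j).ofReal).mul
      (isTorusSmooth_slope hlam v l).ofReal).mul (isTorusSmooth_gain hlam ht v).ofReal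
  | add _ _ hF hG => exact hF.add hG
  | mul _ _ hF hG => exact hF.mul hG

lemma differentiableAt (hlam : IsTorusSmooth lam) (hF : SymbolClass lam N F) {t : ℝ} (ht : 0 < t)
    (v k : Momentum d) : DifferentiableAt ℝ (F t v) k :=
  (hF.isTorusSmooth hlam ht v).smooth.differentiable (by norm_num) k

lemma exists_bound (hlam : IsTorusSmooth lam) (hF : SymbolClass lam N F) :
    ∃ C, ∀ t v k, 0 < t → ‖v‖ ≤ 1 → ‖F t v k‖ ≤ C * BlochLAP.gain lam t v k ^ N := by
  induction hF with
  | zero N => exact ⟨0, fun t v k _ _ => by simp⟩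
  | base hb =>
    obtain ⟨C, hC⟩ := hb.exists_bound
    exact ⟨C, fun t v k _ _ => by simpa using hC k⟩
  | slope j =>
    obtain ⟨C, hC⟩ := (hlam.pderiv j).exists_bound
    refine ⟨C + 1, fun t v k _ hv => ?_⟩
    have h1 : ‖v j‖ ≤ 1 := (PiLp.norm_apply_le v j).trans hv
    rw [pow_zero, mul_one, Complex.norm_real]
    exact (norm_sub_le _ _).trans (add_le_add (hC k) h1)
  | gain =>
    refine ⟨1, fun t v k ht _ => ?_⟩
    simp [abs_of_pos (gain_pos (lam := lam) (v := v) (k := k) ht)]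
  | quad j l =>
    refine ⟨1, fun t v k ht _ => ?_⟩
    rw [Complex.norm_real]
    simpa using abs_mul_slope_mul_gain_le (lam := lam) (v := v) (k := k) ht j l
  | add _ _ hF hG =>
    obtain ⟨C, hC⟩ := hF
    obtain ⟨C', hC'⟩ := hG
    refine ⟨C + C', fun t v k ht hv => ?_⟩
    rw [add_mul]
    exact (norm_add_le _ _).trans (add_le_add (hC t v k ht hv) (hC' t v k ht hv))
  | @mul N M _ _ _ _ hF hG =>
    obtain ⟨C, hC⟩ := hF
    obtain ⟨C', hC'⟩ := hG
    refine ⟨C * C', fun t v k ht hv => ?_⟩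
    rw [norm_mul, pow_add, mul_mul_mul_comm]
    exact mul_le_mul (hC t v k ht hv) (hC' t v k ht hv) (norm_nonneg _)
      ((norm_nonneg _).trans (hC t v k ht hv))

/-- Each `∂_j gain` carries `t * slope_l * gain²`; contraction with `slope_j` completes this to a
`quad` term times `gain`. This is why `quad` is among the generators of `SymbolClass`. -/
lemma exists_drift_gain (hlam : IsTorusSmooth lam) :
    ∃ G, SymbolClass lam 0 G ∧ ∀ t v k, 0 < t →
      BlochLAP.drift lam v (fun k => (BlochLAP.gain lam t v k : ℂ)) k =
        G t v k * BlochLAP.gain lam t v k := by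
  refine ⟨_, sum Finset.univ fun j => sum Finset.univ fun l =>
    ((quad j l).base_mul (isTorusSmooth_hess hlam j l).ofReal).const_mul (-2), ?_⟩
  intro t v k ht
  simp only [BlochLAP.drift, Finset.sum_mul]
  refine Finset.sum_congr rfl fun j _ => ?_
  rw [pderiv_ofReal ((isTorusSmooth_gain hlam ht v).smooth.differentiable (by norm_num) k),
    pderiv_gain hlam ht, Complex.ofReal_sum, Finset.mul_sum]
  refine Finset.sum_congr rfl fun l _ => ?_
  push_cast
  ring

lemma drift_slope (hlam : IsTorusSmooth lam) (v k : Momentum d) (l : Fin d) :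
    BlochLAP.drift lam v (fun k => (BlochLAP.slope lam v l k : ℂ)) k =
      ∑ j, (hess lam j l k : ℂ) * (BlochLAP.slope lam v j k : ℂ) := by
  refine Finset.sum_congr rfl fun j _ => ?_
  rw [pderiv_ofReal ((isTorusSmooth_slope hlam v l).smooth.differentiable (by norm_num) k),
    pderiv_slope, mul_comm]

/-- Induction over the generators with the Leibniz rule. The drift of a slope is a combination of
slopes with Hessian coefficients, so `quad` terms return to `quad` terms and no free power of `t`
appears. -/
lemma exists_drift (hlam : IsTorusSmooth lam) (hF : SymbolClass lam N F) :
    ∃ G, SymbolClass lam N G ∧ ∀ t v k, 0 < t → BlochLAP.drift lam v (F t v) k = G t v k := by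
  induction hF with
  | zero N => exact ⟨_, zero N, fun t v k _ => by simp [BlochLAP.drift, pderiv]⟩
  | base hb =>
    refine ⟨_, sum Finset.univ fun j => (slope j).base_mul (hb.pderiv j), fun t v k _ => ?_⟩
    exact Finset.sum_congr rfl fun j _ => mul_comm _ _
  | slope l =>
    exact ⟨_, sum Finset.univ fun j => (slope j).base_mul (isTorusSmooth_hess hlam j l).ofReal,
      fun t v k _ => drift_slope hlam v k l⟩
  | gain =>
    obtain ⟨G, hG, h⟩ := exists_drift_gain hlam
    refine ⟨_, by simpa using hG.mul gain, h⟩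
  | quad a b =>
    obtain ⟨G, hG, h⟩ := exists_drift_gain hlam
    refine ⟨_, ((sum Finset.univ fun j =>
        (quad j b).base_mul (isTorusSmooth_hess hlam j a).ofReal).add
      (sum Finset.univ fun j =>
        (quad a j).base_mul (isTorusSmooth_hess hlam j b).ofReal)).add (hG.mul (quad a b)), ?_⟩
    intro t v k ht
    have hs : ∀ l, DifferentiableAt ℝ (fun k => (BlochLAP.slope lam v l k : ℂ)) k := fun l =>
      (isTorusSmooth_slope hlam v l).ofReal.smooth.differentiable (by norm_num) k
    have hg : DifferentiableAt ℝ (fun k => (BlochLAP.gain lam t v k : ℂ)) k :=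
      (isTorusSmooth_gain hlam ht v).ofReal.smooth.differentiable (by norm_num) k
    have hd1 : DifferentiableAt ℝ (fun k => (t : ℂ) * (BlochLAP.slope lam v a k : ℂ)) k :=
      (differentiableAt_const _).mul (hs a)
    have hd2 : DifferentiableAt ℝ (fun k => (t : ℂ) * (BlochLAP.slope lam v a k : ℂ) *
      (BlochLAP.slope lam v b k : ℂ)) k := hd1.mul (hs b)
    simp only [Complex.ofReal_mul]
    rw [drift_mul hd2 hg, drift_mul hd1 (hs b), drift_mul (differentiableAt_const _) (hs a), drift_slope hlam, drift_slope hlam, h t v k ht]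
    have h0 : BlochLAP.drift lam v (fun _ => (t : ℂ)) k = 0 := by simp [BlochLAP.drift, pderiv]
    rw [h0]
    have e1 : ∑ j, (hess lam j a k : ℂ) * ((t : ℂ) * (BlochLAP.slope lam v j k : ℂ) *
        (BlochLAP.slope lam v b k : ℂ) * (BlochLAP.gain lam t v k : ℂ)) =
        (t * BlochLAP.slope lam v b k * BlochLAP.gain lam t v k) *
          ∑ j, (hess lam j a k : ℂ) * (BlochLAP.slope lam v j k : ℂ) := by
      rw [Finset.mul_sum]
      exact Finset.sum_congr rfl fun j _ => by ring
    have e2 : ∑ j, (hess lam j b k : ℂ) * ((t : ℂ) * (BlochLAP.slope lam v a k : ℂ) *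
        (BlochLAP.slope lam v j k : ℂ) * (BlochLAP.gain lam t v k : ℂ)) =
        (t * BlochLAP.slope lam v a k * BlochLAP.gain lam t v k) *
          ∑ j, (hess lam j b k : ℂ) * (BlochLAP.slope lam v j k : ℂ) := by
      rw [Finset.mul_sum]
      exact Finset.sum_congr rfl fun j _ => by ring
    rw [e1, e2]
    ring
  | add hF hG ihF ihG =>
    obtain ⟨F', hF', h1⟩ := ihF
    obtain ⟨G', hG', h2⟩ := ihG
    refine ⟨_, hF'.add hG', fun t v k ht => ?_⟩
    rw [drift_add (hF.differentiableAt hlam ht v k) (hG.differentiableAt hlam ht v k), h1 t v k ht,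
      h2 t v k ht]
  | mul hF hG ihF ihG =>
    obtain ⟨F', hF', h1⟩ := ihF
    obtain ⟨G', hG', h2⟩ := ihG
    refine ⟨_, (hF'.mul hG).add (hF.mul hG'), fun t v k ht => ?_⟩
    rw [drift_mul (hF.differentiableAt hlam ht v k) (hG.differentiableAt hlam ht v k), h1 t v k ht,
      h2 t v k ht]

/-- The adjoint of `gain * (1 + I * drift)` raises the order by one. -/
lemma exists_transpose (hlam : IsTorusSmooth lam) (hF : SymbolClass lam N F) :
    ∃ G, SymbolClass lam (N + 1) G ∧ ∀ t v k, 0 < t →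
      G t v k = BlochLAP.gain lam t v k * F t v k - Complex.I * ∑ j, pderiv j
        (fun k => BlochLAP.gain lam t v k * F t v k * BlochLAP.slope lam v j k) k := by
  obtain ⟨F', hF', h1⟩ := (hF.mul gain).exists_drift hlam
  refine ⟨_, (hF.mul gain).add ((hF'.add ((sum Finset.univ fun j =>
    (hF.mul gain).base_mul (isTorusSmooth_hess hlam j j).ofReal))).const_mul (-Complex.I)), ?_⟩
  intro t v k ht
  have hs : ∀ l, DifferentiableAt ℝ (fun k => (BlochLAP.slope lam v l k : ℂ)) k := fun l =>
    (isTorusSmooth_slope hlam v l).ofReal.smooth.differentiable (by norm_num) k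
  have hg := (hF.mul gain).differentiableAt hlam ht v k
  have e : ∀ j, pderiv j (fun k => BlochLAP.gain lam t v k * F t v k * BlochLAP.slope lam v j k) k =
      BlochLAP.slope lam v j k * pderiv j (fun k => F t v k * BlochLAP.gain lam t v k) k +
        hess lam j j k * (F t v k * BlochLAP.gain lam t v k) := by
    intro j
    simp only [mul_comm (BlochLAP.gain lam t v _ : ℂ)]
    rw [pderiv_mul hg (hs j),
      pderiv_ofReal ((isTorusSmooth_slope hlam v j).smooth.differentiable (by norm_num) k),
      pderiv_slope]
    ring
  simp only [e, Finset.sum_add_distrib]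
  rw [← h1 t v k ht, BlochLAP.drift]
  ring

end SymbolClass

/-- The plane wave `exp(-it(λ(k) - k·v))`. -/
def wave (lam : Momentum d → ℝ) (t : ℝ) (v k : Momentum d) : ℂ :=
  Complex.exp (-Complex.I * ((t * (lam k - ∑ i, k i * v i) : ℝ) : ℂ))

section Wave

variable {lam : Momentum d → ℝ} {t : ℝ} {v : Momentum d}

lemma norm_wave (k : Momentum d) : ‖wave lam t v k‖ = 1 := by
  rw [wave, Complex.norm_exp]
  simp

lemma isTorusSmooth_wave (hlam : IsTorusSmooth lam) {n : Fin d → ℤ}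
    (hn : ∀ i, t * v i = n i) : IsTorusSmooth (wave lam t v) where
  smooth := by
    refine Complex.contDiff_exp.comp (contDiff_const.mul (Complex.ofRealCLM.contDiff.comp
      (contDiff_const.mul (hlam.smooth.sub (ContDiff.sum fun i _ => ContDiff.mul ?_ contDiff_const)))))
    exact (EuclideanSpace.proj (𝕜 := ℝ) i).contDiff
  periodic m k := by
    have h : t * (lam (k + period m) - ∑ i, (k + period m) i * v i) =
        t * (lam k - ∑ i, k i * v i) - 2 * Real.pi * ((∑ i, m i * n i : ℤ) : ℝ) := by
      rw [hlam.periodic]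
      have : ∑ i, (k + period m) i * v i = ∑ i, k i * v i + ∑ i, 2 * Real.pi * m i * v i := by
        rw [← Finset.sum_add_distrib]
        exact Finset.sum_congr rfl fun i _ => by simp [add_mul]
      rw [this, Int.cast_sum, mul_sub, mul_sub, mul_add, ← sub_sub, Finset.mul_sum _ _ (2 * Real.pi),
        Finset.mul_sum _ (fun i => 2 * Real.pi * (m i : ℝ) * v i) t]
      congr 1
      refine Finset.sum_congr rfl fun i _ => ?_
      push_cast
      rw [← hn i]
      ring
    unfold wave
    rw [h]
    refine Complex.exp_eq_exp_iff_exists_int.2 ⟨∑ i, m i * n i, ?_⟩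
    push_cast
    ring

lemma pderiv_wave (hlam : IsTorusSmooth lam) (j : Fin d) (k : Momentum d) :
    pderiv j (wave lam t v) k = -Complex.I * t * slope lam v j k * wave lam t v k := by
  have h1 : HasFDerivAt lam (fderiv ℝ lam k) k :=
    (hlam.smooth.differentiable (by norm_num) k).hasFDerivAt
  have h2 : ∀ i, HasFDerivAt (fun k : Momentum d => k i) (EuclideanSpace.proj (𝕜 := ℝ) i) k :=
    fun i => (EuclideanSpace.proj (𝕜 := ℝ) i).hasFDerivAt
  have h3 := (h1.fun_sub (HasFDerivAt.fun_sum (u := Finset.univ)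
    fun i _ => (h2 i).mul_const (v i))).const_mul t
  have h4 := ((Complex.ofRealCLM.hasFDerivAt.comp k h3).const_mul (-Complex.I)).cexp
  have h5 : pderiv j (wave lam t v) k = _ := congrArg (fun f => f (coordVec j)) h4.fderiv
  rw [h5]
  have h6 : ∑ i, v i * (coordVec j : Momentum d) i = v j := by
    rw [Finset.sum_eq_single j] <;> simp +contextual [coordVec]
  simp only [_root_.smul_apply, ContinuousLinearMap.comp_apply,
    _root_.sub_apply, _root_.sum_apply, smul_eq_mul,
    PiLp.proj_apply, h6]
  simp only [Function.comp_def, wave, slope, pderiv, Complex.ofRealCLM_apply]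
  push_cast
  ring

/-- As `∂_j wave = -i t slope_j wave`, the operator `gain * (1 + I * drift)` fixes `wave`, and `G`
is its transpose applied to `F`. No boundary term survives because `t v ∈ ℤ^d` makes `wave`
periodic. -/
lemma integral_cell_mul_wave_eq (hlam : IsTorusSmooth lam) (ht : 0 < t) {n : Fin d → ℤ}
    (hn : ∀ i, t * v i = n i) {F G : Momentum d → ℂ} (hF : IsTorusSmooth F)
    (hG : IsTorusSmooth G)
    (hFG : ∀ k, G k = gain lam t v k * F k - Complex.I * ∑ j, pderiv j
        (fun k => gain lam t v k * F k * slope lam v j k) k) :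
    ∫ k in cell d, F k * wave lam t v k = ∫ k in cell d, G k * wave lam t v k := by
  have hw := isTorusSmooth_wave hlam hn
  have hA : ∀ j, IsTorusSmooth (fun k => (gain lam t v k * F k * slope lam v j k : ℂ)) := fun j =>
    ((isTorusSmooth_gain hlam ht v).ofReal.mul hF).mul (isTorusSmooth_slope hlam v j).ofReal
  have key : ∀ k, F k * wave lam t v k - G k * wave lam t v k = Complex.I * ∑ j, pderiv j
      (fun k => (gain lam t v k * F k * slope lam v j k : ℂ) * wave lam t v k) k := by
    intro k
    have e : ∀ j, pderiv j
        (fun k => (gain lam t v k * F k * slope lam v j k : ℂ) * wave lam t v k) k =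
        pderiv j (fun k => (gain lam t v k * F k * slope lam v j k : ℂ)) k * wave lam t v k +
          (gain lam t v k * F k * -Complex.I * wave lam t v k) *
            (t * (slope lam v j k : ℂ) ^ 2) := by
      intro j
      rw [pderiv_mul ((hA j).smooth.differentiable (by norm_num) k)
        (hw.smooth.differentiable (by norm_num) k), pderiv_wave hlam]
      ring
    have hgain : (gain lam t v k : ℂ) * (1 + t * ∑ j, (slope lam v j k : ℂ) ^ 2) = 1 := by
      have := inv_mul_cancel₀ (gain_den_pos (lam := lam) (v := v) (k := k) ht).ne'
      exact_mod_cast this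
    rw [Finset.sum_congr rfl fun j _ => e j, Finset.sum_add_distrib, ← Finset.sum_mul,
      ← Finset.mul_sum, ← Finset.mul_sum, hFG k]
    linear_combination (-F k * wave lam t v k) * hgain +
      (gain lam t v k * F k * wave lam t v k * (t * ∑ j, (slope lam v j k : ℂ) ^ 2)) *
        Complex.I_mul_I
  rw [← sub_eq_zero, ← integral_sub
    (Continuous.integrableOn_cell (hF.mul hw).smooth.continuous)
    (Continuous.integrableOn_cell (hG.mul hw).smooth.continuous)]
  simp only [key]
  rw [integral_const_mul, integral_finsetSum]
  · rw [Finset.sum_eq_zero, mul_zero]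
    intro j _
    exact integral_cell_pderiv_eq_zero
      (((hA j).mul hw).smooth.of_le (by norm_cast)) ((hA j).mul hw).periodic j
  · intro j _
    exact Continuous.integrableOn_cell (((hA j).mul hw).pderiv j).smooth.continuous

/-- Repeated integration by parts against `wave`. -/
lemma exists_norm_integral_cell_mul_wave_le (hlam : IsTorusSmooth lam) {a : Momentum d → ℂ}
    (ha : IsTorusSmooth a) (N : ℕ) :
    ∃ C, 0 ≤ C ∧ ∀ (t : ℝ) (v : Momentum d) (n : Fin d → ℤ), 0 < t → ‖v‖ ≤ 1 →
      (∀ i, t * v i = n i) →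
      ‖∫ k in cell d, a k * wave lam t v k‖ ≤ C * ∫ k in cell d, gain lam t v k ^ N := by
  -- A single family `F` serves all `t` and `v`, which makes the constant in its bound by `gain ^ N`
  -- uniform.
  obtain ⟨F, hF, h⟩ : ∃ F, SymbolClass lam N F ∧ ∀ (t : ℝ) (v : Momentum d) (n : Fin d → ℤ),
      0 < t → (∀ i, t * v i = n i) →
        ∫ k in cell d, a k * wave lam t v k = ∫ k in cell d, F t v k * wave lam t v k := by
    induction N with
    | zero => exact ⟨_, SymbolClass.base ha, fun _ _ _ _ _ => rfl⟩
    | succ N ih =>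
      obtain ⟨F, hF, h⟩ := ih
      obtain ⟨G, hG, hFG⟩ := hF.exists_transpose hlam
      refine ⟨G, hG, fun t v n ht hn => (h t v n ht hn).trans ?_⟩
      exact integral_cell_mul_wave_eq hlam ht hn (hF.isTorusSmooth hlam ht v)
        (hG.isTorusSmooth hlam ht v) fun k => hFG t v k ht
  obtain ⟨C, hC⟩ := hF.exists_bound hlam
  refine ⟨max C 0, le_max_right _ _, fun t v n ht hv hn => ?_⟩
  rw [h t v n ht hn, ← integral_const_mul]
  refine norm_integral_le_of_norm_le (Continuous.integrableOn_cell (continuous_const.mul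
    ((isTorusSmooth_gain hlam ht v).smooth.continuous.pow N))) (Eventually.of_forall fun k => ?_)
  rw [norm_mul, norm_wave, mul_one]
  refine (hC t v k ht hv).trans ?_
  have := pow_pos (gain_pos (lam := lam) (v := v) (k := k) ht) N
  gcongr
  exact le_max_left _ _

end Wave

end BlochLAP

end

/-! ### Stationary phase for Morse functions on the torus. -/

noncomputable section

namespace BlochLAP

open MeasureTheory Set
open scoped ContDiff

variable {d L : ℕ}

lemma gradient_apply (f : Momentum d → ℝ) (k : Momentum d) (j : Fin d) :
    gradient f k j = pderiv j f k := by
  have h : inner ℝ (gradient f k) (coordVec j) = fderiv ℝ f k (coordVec j) := inner_gradient_left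
  rw [pderiv, ← h]
  exact (EuclideanSpace.inner_single_right j (1 : ℝ) (gradient f k)).trans (by simp) |>.symm

lemma gain_eq (lam : Momentum d → ℝ) (t : ℝ) (v k : Momentum d) :
    gain lam t v k = (1 + t * ‖gradient lam k - v‖ ^ 2)⁻¹ := by
  rw [EuclideanSpace.norm_sq_eq]
  simp [gain, slope, gradient_apply]

lemma contDiff_gradient {lam : Momentum d → ℝ} (h : ContDiff ℝ ∞ lam) :
    ContDiff ℝ ∞ (gradient lam) :=
  (InnerProductSpace.toDual ℝ (Momentum d)).symm.toContinuousLinearEquiv.contDiff.comp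
    (h.fderiv_right (m := ∞) (by norm_cast))

lemma integrable_inv_one_add_norm_sq_pow :
    Integrable fun y : Momentum d => ((1 + ‖y‖ ^ 2)⁻¹) ^ (d + 1) := by
  have h := integrable_rpow_neg_one_add_norm_sq (E := Momentum d) (μ := volume)
    (r := 2 * ((d : ℝ) + 1)) (by rw [finrank_euclideanSpace_fin]; linarith [d.cast_nonneg (α := ℝ)])
  refine h.congr (Eventually.of_forall fun y => ?_)
  have hy : 0 ≤ 1 + ‖y‖ ^ 2 := by positivity
  simp only
  rw [show -(2 * ((d : ℝ) + 1)) / 2 = -((d + 1 : ℕ) : ℝ) by push_cast; ring, Real.rpow_neg hy,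
    Real.rpow_natCast, inv_pow]

/-- The substitution `√t (y - v)` produces `t^{-d/2}`. Any power above `d/2` would be integrable; `d
+ 1` is a convenient integer. -/
lemma exists_lintegral_inv_one_add_mul_norm_sq_pow_le (d : ℕ) :
    ∃ K : ℝ, 0 ≤ K ∧ ∀ (t : ℝ) (v : Momentum d), 0 < t →
      ∫⁻ y : Momentum d, ENNReal.ofReal ((1 + t * ‖y - v‖ ^ 2)⁻¹ ^ (d + 1)) ≤
        ENNReal.ofReal (K * t ^ (-(d : ℝ) / 2)) := by
  set f : Momentum d → ℝ := fun y => ((1 + ‖y‖ ^ 2)⁻¹) ^ (d + 1) with hf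
  have hfi : Integrable f := integrable_inv_one_add_norm_sq_pow
  refine ⟨∫ y, f y, integral_nonneg fun y => by positivity, fun t v ht => ?_⟩
  have hs : 0 < √t := Real.sqrt_pos.2 ht
  have e : ∀ y : Momentum d, (1 + t * ‖y - v‖ ^ 2)⁻¹ ^ (d + 1) = f (√t • (y - v)) := by
    intro y
    rw [hf]
    simp only [norm_smul, Real.norm_of_nonneg hs.le, mul_pow, Real.sq_sqrt ht.le]
  simp only [e]
  rw [← ofReal_integral_eq_lintegral_ofReal ((hfi.comp_smul hs.ne').comp_sub_right v)
    (Eventually.of_forall fun y => by simp only [hf]; positivity)]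
  refine ENNReal.ofReal_le_ofReal (le_of_eq ?_)
  rw [integral_sub_right_eq_self (fun y => f (√t • y)) v, Measure.integral_comp_smul,
    finrank_euclideanSpace_fin, abs_of_pos (by positivity), smul_eq_mul, mul_comm]
  congr 1
  rw [Real.sqrt_eq_rpow, ← Real.rpow_natCast, ← Real.rpow_mul ht.le, ← Real.rpow_neg ht.le]
  congr 1
  ring

/-- Non-stationary regime: `gain = O(1/t)`, and the power `d + 1` exceeds `d/2`. -/
lemma gain_pow_le {lam : Momentum d → ℝ} {t δ : ℝ} {v k : Momentum d} (ht : 1 ≤ t) (hδ : 0 < δ)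
    (h : δ ≤ ‖gradient lam k - v‖) :
    gain lam t v k ^ (d + 1) ≤ (δ ^ 2)⁻¹ ^ (d + 1) * t ^ (-(d : ℝ) / 2) := by
  have ht0 : 0 < t := by linarith
  have h1 : gain lam t v k ≤ (δ ^ 2)⁻¹ * t⁻¹ := by
    rw [gain_eq, ← mul_inv]
    apply inv_anti₀ (by positivity)
    have : δ ^ 2 ≤ ‖gradient lam k - v‖ ^ 2 := by gcongr
    nlinarith
  have h2 : t⁻¹ ^ (d + 1) ≤ t ^ (-(d : ℝ) / 2) := by
    rw [← Real.rpow_natCast, ← Real.rpow_neg_one, ← Real.rpow_mul ht0.le]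
    apply Real.rpow_le_rpow_of_exponent_le ht
    push_cast
    linarith [d.cast_nonneg (α := ℝ)]
  calc gain lam t v k ^ (d + 1) ≤ ((δ ^ 2)⁻¹ * t⁻¹) ^ (d + 1) :=
        pow_le_pow_left₀ (gain_pos ht0).le h1 _
    _ = (δ ^ 2)⁻¹ ^ (d + 1) * t⁻¹ ^ (d + 1) := mul_pow _ _ _
    _ ≤ _ := by gcongr

/-- The gain is small in mean near `S`, uniformly for small velocities. -/
def HasGainBound (lam : Momentum d → ℝ) (S : Set (Momentum d)) : Prop :=
  ∃ C c : ℝ, 0 ≤ C ∧ 0 < c ∧ ∀ (t : ℝ) (v : Momentum d), 1 ≤ t → ‖v‖ ≤ c →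
    ∫⁻ k in S, ENNReal.ofReal (gain lam t v k ^ (d + 1)) ≤ ENNReal.ofReal (C * t ^ (-(d : ℝ) / 2))

namespace HasGainBound

variable {lam : Momentum d → ℝ}

lemma mono {S T : Set (Momentum d)} (hST : S ⊆ T) (hT : HasGainBound lam T) :
    HasGainBound lam S := by
  obtain ⟨C, c, hC, hc, h⟩ := hT
  exact ⟨C, c, hC, hc, fun t v ht hv => (lintegral_mono_set hST).trans (h t v ht hv)⟩

lemma union {S T : Set (Momentum d)} (hS : HasGainBound lam S) (hT : HasGainBound lam T) :
    HasGainBound lam (S ∪ T) := by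
  obtain ⟨C, c, hC, hc, h⟩ := hS
  obtain ⟨C', c', hC', hc', h'⟩ := hT
  refine ⟨C + C', min c c', add_nonneg hC hC', lt_min hc hc', fun t v ht hv => ?_⟩
  have ht0 : 0 ≤ t := by linarith
  rw [add_mul, ENNReal.ofReal_add (by positivity) (by positivity)]
  exact (lintegral_union_le _ _ _).trans (add_le_add (h t v ht (hv.trans (min_le_left _ _)))
    (h' t v ht (hv.trans (min_le_right _ _))))

/-- With `δ = |∇λ(k₀)|`, the gradient exceeds `δ/2` near `k₀`, so velocities up to `δ/4` keep `|∇λ -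
v| ≥ δ/4`. -/
lemma exists_nhds_of_gradient_ne_zero (hlam : ContDiff ℝ ∞ lam) {k₀ : Momentum d}
    (h₀ : gradient lam k₀ ≠ 0) : ∃ S ∈ 𝓝 k₀, HasGainBound lam S := by
  set δ := ‖gradient lam k₀‖ with hδ
  have hδ0 : 0 < δ := norm_pos_iff.2 h₀
  have hopen : {k | δ / 2 < ‖gradient lam k‖} ∈ 𝓝 k₀ :=
    ((contDiff_gradient hlam).continuous.norm.isOpen_preimage _ isOpen_Ioi).mem_nhds
      (show δ / 2 < ‖gradient lam k₀‖ by rw [← hδ]; linarith)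
  refine ⟨_, inter_mem hopen (Metric.ball_mem_nhds k₀ one_pos), ?_⟩
  refine ⟨((δ / 4) ^ 2)⁻¹ ^ (d + 1) * volume.real (Metric.ball k₀ 1), δ / 4, by positivity,
    by positivity, fun t v ht hv => ?_⟩
  have ht0 : 0 ≤ t := by linarith
  calc ∫⁻ k in {k | δ / 2 < ‖gradient lam k‖} ∩ Metric.ball k₀ 1,
        ENNReal.ofReal (gain lam t v k ^ (d + 1))
      ≤ ∫⁻ k in {k | δ / 2 < ‖gradient lam k‖} ∩ Metric.ball k₀ 1,
        ENNReal.ofReal (((δ / 4) ^ 2)⁻¹ ^ (d + 1) * t ^ (-(d : ℝ) / 2)) := by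
        refine setLIntegral_mono measurable_const fun k hk => ENNReal.ofReal_le_ofReal ?_
        refine gain_pow_le ht (by positivity) ?_
        have h1 : δ / 2 < ‖gradient lam k‖ := hk.1
        linarith [norm_sub_norm_le (gradient lam k) v]
    _ ≤ ENNReal.ofReal (((δ / 4) ^ 2)⁻¹ ^ (d + 1) * t ^ (-(d : ℝ) / 2)) *
          volume (Metric.ball k₀ 1) := by
        rw [setLIntegral_const]
        gcongr
        exact inter_subset_right
    _ = _ := by
        rw [← ENNReal.ofReal_toReal (measure_ball_lt_top (x := k₀) (r := 1)).ne,
          ← ENNReal.ofReal_mul (by positivity)]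
        congr 1
        simp only [Measure.real]
        ring

/-- By the inverse function theorem `∇λ` is injective near `k₀`, with Jacobian bounded below;
substituting `y = ∇λ(k)` leaves an integral bounded uniformly in all `v`, so the velocity threshold
`1` is arbitrary. -/
lemma exists_nhds_of_hessian_det_ne_zero (hlam : ContDiff ℝ ∞ lam) {k₀ : Momentum d}
    (h₀ : (hessian lam k₀).det ≠ 0) : ∃ S ∈ 𝓝 k₀, HasGainBound lam S := by
  have hG := contDiff_gradient hlam
  have hd : ∀ k, HasFDerivAt (gradient lam) (hessian lam k) k := fun k =>
    (hG.differentiable (by norm_num) k).hasFDerivAt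
  let e := (hG.contDiffAt (x := k₀)).toOpenPartialHomeomorph
    (f' := (hessian lam k₀).toContinuousLinearEquivOfDetNeZero h₀) (gradient lam)
    (hd k₀) (by norm_num)
  have hsrc : e.source ∈ 𝓝 k₀ :=
    e.open_source.mem_nhds (ContDiffAt.mem_toOpenPartialHomeomorph_source _ _ _)
  set D := |(hessian lam k₀).det| with hD
  have hD0 : 0 < D := abs_pos.2 h₀
  have hcont : Continuous fun k => |(hessian lam k).det| :=
    (ContinuousLinearMap.continuous_det.comp (hG.continuous_fderiv (by norm_num))).abs
  have hopen : IsOpen {k | D / 2 < |(hessian lam k).det|} := isOpen_lt continuous_const hcont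
  have hmem : {k | D / 2 < |(hessian lam k).det|} ∈ 𝓝 k₀ :=
    hopen.mem_nhds (show D / 2 < |(hessian lam k₀).det| by rw [← hD]; linarith)
  refine ⟨_, inter_mem hsrc hmem, ?_⟩
  set S := e.source ∩ {k | D / 2 < |(hessian lam k).det|} with hS
  have hSm : MeasurableSet S := (e.open_source.inter hopen).measurableSet
  obtain ⟨K, hK, hKb⟩ := exists_lintegral_inv_one_add_mul_norm_sq_pow_le d
  refine ⟨(D / 2)⁻¹ * K, 1, by positivity, one_pos, fun t v ht _ => ?_⟩
  have ht0 : 0 < t := by linarith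
  have h1 := lintegral_image_eq_lintegral_abs_det_fderiv_mul volume hSm
    (fun k _ => (hd k).hasFDerivWithinAt) (e.injOn.mono inter_subset_left)
    (fun y => ENNReal.ofReal ((1 + t * ‖y - v‖ ^ 2)⁻¹ ^ (d + 1)))
  have h2 : ENNReal.ofReal (D / 2) * ∫⁻ k in S, ENNReal.ofReal (gain lam t v k ^ (d + 1)) ≤
      ENNReal.ofReal (K * t ^ (-(d : ℝ) / 2)) := by
    rw [← lintegral_const_mul' _ _ ENNReal.ofReal_ne_top]
    calc _ ≤ ∫⁻ k in S, ENNReal.ofReal |(hessian lam k).det| *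
          ENNReal.ofReal ((1 + t * ‖gradient lam k - v‖ ^ 2)⁻¹ ^ (d + 1)) := by
          refine setLIntegral_mono' hSm fun k hk => ?_
          rw [gain_eq]
          gcongr
          exact (show D / 2 < |(hessian lam k).det| from hk.2).le
      _ = _ := h1.symm
      _ ≤ _ := setLIntegral_le_lintegral _ _
      _ ≤ _ := hKb t v ht0
  have h3 : ENNReal.ofReal ((D / 2)⁻¹) * ENNReal.ofReal (D / 2) = 1 := by
    rw [← ENNReal.ofReal_mul (by positivity), inv_mul_cancel₀ (by positivity), ENNReal.ofReal_one]
  calc _ = ENNReal.ofReal ((D / 2)⁻¹) * (ENNReal.ofReal (D / 2) *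
        ∫⁻ k in S, ENNReal.ofReal (gain lam t v k ^ (d + 1))) := by rw [← mul_assoc, h3, one_mul]
    _ ≤ ENNReal.ofReal ((D / 2)⁻¹) * ENNReal.ofReal (K * t ^ (-(d : ℝ) / 2)) := by gcongr
    _ = _ := by rw [← ENNReal.ofReal_mul (by positivity), mul_assoc]

/-- Compactness reduces the bound to a neighbourhood of each point, critical or not. Lower integrals
pass to subsets and unions without measurability conditions, as the induction over compact sets
requires. -/
lemma cell (hlam : ContDiff ℝ ∞ lam)
    (hM : ∀ k, gradient lam k = 0 → (hessian lam k).det ≠ 0) :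
    HasGainBound lam (cell d) := by
  refine isCompact_cell.induction_on ⟨0, 1, le_rfl, one_pos, fun t v _ _ => by simp⟩
    (fun _ _ h => mono h) (fun _ _ => union) fun k _ => ?_
  obtain ⟨S, hS, h⟩ : ∃ S ∈ 𝓝 k, HasGainBound lam S := by
    by_cases h : gradient lam k = 0
    · exact exists_nhds_of_hessian_det_ne_zero hlam (hM k h)
    · exact exists_nhds_of_gradient_ne_zero hlam h
  exact ⟨S, mem_nhdsWithin_of_mem_nhds hS, h⟩

end HasGainBound

/-- Stationary phase for a Morse function on the torus, uniform for small velocities. -/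
theorem exists_norm_integral_cell_le_of_morse {lam : Momentum d → ℝ} (hlam : IsTorusSmooth lam)
    (hM : ∀ k, gradient lam k = 0 → (hessian lam k).det ≠ 0) {a : Momentum d → ℂ}
    (ha : IsTorusSmooth a) :
    ∃ C c : ℝ, 0 ≤ C ∧ 0 < c ∧ ∀ (t : ℝ) (n : Fin d → ℤ), 1 ≤ t →
      ‖(WithLp.toLp 2 fun i => (n i : ℝ) : Momentum d)‖ ≤ c * t →
      ‖∫ k in cell d, a k * Complex.exp (-Complex.I * ((t * lam k - ∑ i, k i * n i : ℝ) : ℂ))‖ ≤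
        C * t ^ (-(d : ℝ) / 2) := by
  obtain ⟨C, c, hC, hc, h⟩ := HasGainBound.cell hlam.smooth hM
  obtain ⟨C', hC', h'⟩ := exists_norm_integral_cell_mul_wave_le hlam ha (d + 1)
  -- The aperture of the cone: `c` serves the integral of the gain, `1` the bounds on the
  -- amplitudes.
  refine ⟨C' * C, min c 1, by positivity, lt_min hc one_pos, fun t n ht hn => ?_⟩
  have ht0 : 0 < t := by linarith
  set v : Momentum d := t⁻¹ • (WithLp.toLp 2 fun i => (n i : ℝ) : Momentum d) with hv
  have htv : ∀ i, t * v i = n i := fun i => by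
    simp only [hv, PiLp.smul_apply, smul_eq_mul]
    field_simp
  have hvn : ‖v‖ ≤ min c 1 := by
    rw [hv, norm_smul, norm_inv, Real.norm_of_nonneg ht0.le, inv_mul_le_iff₀ ht0, mul_comm]
    exact hn
  have e : ∀ k : Momentum d, Complex.exp (-Complex.I * ((t * lam k - ∑ i, k i * n i : ℝ) : ℂ)) =
      wave lam t v k := fun k => by
    rw [wave, mul_sub, Finset.mul_sum]
    simp only [← htv]
    congr 5
    funext i
    ring
  simp only [e]
  refine (h' t v n ht0 (hvn.trans (min_le_right _ _)) htv).trans ?_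
  rw [mul_assoc]
  gcongr
  rw [integral_eq_lintegral_of_nonneg_ae
    (Eventually.of_forall fun k => (pow_pos (gain_pos ht0) _).le)
    ((isTorusSmooth_gain hlam ht0 v).smooth.continuous.pow _).aestronglyMeasurable]
  exact ENNReal.toReal_le_of_le_ofReal (by positivity) (h t v ht (hvn.trans (min_le_left _ _)))

end BlochLAP

end

/-! ### Global analytic bands and smooth spectral projections. -/

noncomputable section

namespace BlochLAP

open MeasureTheory Set
open scoped ContDiff

variable {d L : ℕ}

/-- Matching the values defines a strictly monotone self-map of `Fin m`, which can only be the
identity. -/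
lemma strictAnti_eq_of_forall_mem_range {m : ℕ} {x y : Fin m → ℝ} (hx : StrictAnti x)
    (hy : StrictAnti y) (h : ∀ j, x j ∈ range y) : x = y := by
  choose τ hτ using h
  have hmono : StrictMono τ := fun a b hab => by
    by_contra! hcon
    have := hy.antitone hcon
    rw [hτ, hτ] at this
    exact absurd (hx hab) (not_lt.2 this)
  have hbij : Function.Bijective τ := Finite.injective_iff_bijective.1 hmono.injective
  have hid : (hmono.orderIsoOfSurjective τ hbij.2) = OrderIso.refl _ := Subsingleton.elim _ _
  funext j
  have : τ j = j := congrArg (fun e : Fin m ≃o Fin m => e j) hid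
  rw [← hτ j, this]

/-- The simple real roots of a polynomial depend analytically on parameters. -/
lemma analyticAt_of_eq_prod {E : Type*} [NormedAddCommGroup E] [NormedSpace ℝ E] [CompleteSpace E]
    {m : ℕ} {lam : Fin m → E → ℝ} (hanti : ∀ k, StrictAnti fun j => lam j k) {F : E × ℝ → ℝ}
    (hF : ContDiff ℝ ω F) (hprod : ∀ k x, F (k, x) = ∏ i, (x - lam i k)) (j : Fin m) (k₀ : E) :
    AnalyticAt ℝ (lam j) k₀ := by
  have hroot : ∀ i k, F (k, lam i k) = 0 := fun i k => by
    rw [hprod]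
    exact Finset.prod_eq_zero (Finset.mem_univ i) (sub_self _)
  -- Continuity of `lam i` is not presupposed. The implicit function theorem yields analytic roots
  -- through the points `lam i k₀`; near `k₀` they keep their order, and this alone identifies them
  -- with the sorted roots.
  have hlocal : ∀ i, ∃ x : E → ℝ, ContDiffAt ℝ ω x k₀ ∧ x k₀ = lam i k₀ ∧
      ∀ᶠ k in 𝓝 k₀, x k ∈ range fun l => lam l k := by
    intro i
    have hcd : ContDiffAt ℝ ω F (k₀, lam i k₀) := hF.contDiffAt
    have hder : HasDerivAt (fun x => F (k₀, x))
        (fderiv ℝ F (k₀, lam i k₀) (0, 1)) (lam i k₀) := by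
      have h1 := (hF.differentiable (by simp) (k₀, lam i k₀)).hasFDerivAt
      have h2 : HasDerivAt (fun x : ℝ => (k₀, x)) ((0, 1) : E × ℝ) (lam i k₀) :=
        (hasDerivAt_const _ _).prodMk (hasDerivAt_id _)
      exact h1.comp_hasDerivAt _ h2
    have hder2 : HasDerivAt (fun x => F (k₀, x))
        (∏ l ∈ Finset.univ.erase i, (lam i k₀ - lam l k₀)) (lam i k₀) := by
      have h3 := (Lagrange.nodal Finset.univ fun l => lam l k₀).hasDerivAt (lam i k₀)
      rw [Lagrange.eval_nodal_derivative_eval_node_eq (v := fun l => lam l k₀) (Finset.mem_univ i),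
        Lagrange.eval_nodal] at h3
      refine h3.congr_of_eventuallyEq (Eventually.of_forall fun x => ?_)
      simp only [hprod, Lagrange.eval_nodal]
    have hne : fderiv ℝ F (k₀, lam i k₀) (0, 1) ≠ 0 := by
      rw [hder.unique hder2, Finset.prod_ne_zero_iff]
      intro l hl
      exact sub_ne_zero.2 fun h => (Finset.ne_of_mem_erase hl) ((hanti k₀).injective h).symm
    have hinv : (fderiv ℝ F (k₀, lam i k₀) ∘L .inr ℝ E ℝ).IsInvertible := by
      refine ⟨ContinuousLinearEquiv.unitsEquivAut ℝ (Units.mk0 _ hne), ?_⟩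
      ext
      simp
    refine ⟨hcd.implicitFunction (by simp) hinv, hcd.contDiffAt_implicitFunction (by simp) hinv,
      hcd.implicitFunction_apply_self (by simp) hinv, ?_⟩
    filter_upwards [hcd.eventually_apply_implicitFunction (by simp) hinv] with k hk
    rw [hroot, hprod, Finset.prod_eq_zero_iff] at hk
    obtain ⟨l, _, hl⟩ := hk
    exact ⟨l, (sub_eq_zero.1 hl).symm⟩
  choose x hx hx0 hxr using hlocal
  have hlt : ∀ᶠ k in 𝓝 k₀, ∀ i l : Fin m, i < l → x l k < x i k := by
    simp only [eventually_all]
    intro i l hil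
    refine (hx l).continuousAt.eventually_lt (hx i).continuousAt ?_
    rw [hx0, hx0]
    exact hanti k₀ hil
  have heq : lam j =ᶠ[𝓝 k₀] x j := by
    filter_upwards [hlt, eventually_all.2 hxr] with k h1 h2
    exact (congrFun (strictAnti_eq_of_forall_mem_range (x := fun i => x i k)
      (fun i l hil => h1 i l hil) (hanti k) h2) j).symm
  exact (hx j).analyticAt.congr heq.symm

/-- Lagrange interpolation of the powers of a matrix with simple spectrum. -/
lemma pow_eq_sum_smul_aeval_basis {ι n : Type*} [Fintype ι] [DecidableEq ι] [Fintype n]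
    [DecidableEq n] {A : Matrix n n ℂ} {v : ι → ℂ} (hv : Function.Injective v)
    (hA : A.charpoly = Lagrange.nodal Finset.univ v) (p : ℕ) :
    A ^ p = ∑ j, v j ^ p • Polynomial.aeval A (Lagrange.basis Finset.univ v j) := by
  -- The difference vanishes at each of the distinct nodes, so the characteristic polynomial divides
  -- it and Cayley–Hamilton finishes.
  have hdvd : Lagrange.nodal Finset.univ v ∣
      Polynomial.X ^ p - Lagrange.interpolate Finset.univ v (fun j => v j ^ p) := by
    rw [Lagrange.nodal_eq]
    refine Finset.prod_dvd_of_coprime (fun i _ j _ hij =>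
      Polynomial.pairwise_coprime_X_sub_C hv hij) fun i _ => ?_
    rw [Polynomial.dvd_iff_isRoot, Polynomial.IsRoot, Polynomial.eval_sub, Polynomial.eval_pow,
      Polynomial.eval_X, Lagrange.eval_interpolate_at_node _ hv.injOn (Finset.mem_univ i), sub_self]
  obtain ⟨q, hq⟩ := hdvd
  have h := congrArg (Polynomial.aeval A) hq
  rw [map_mul, ← hA, Matrix.aeval_self_charpoly, zero_mul, map_sub, sub_eq_zero, map_pow,
    Polynomial.aeval_X, Lagrange.interpolate_apply, map_sum] at h
  rw [h]
  refine Finset.sum_congr rfl fun j _ => ?_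
  rw [map_mul, Polynomial.aeval_C, Algebra.smul_def]

/-- Smooth periodic matrix-valued functions. -/
def IsTorusSmoothMatrix (A : Momentum d → Matrix (Fin L) (Fin L) ℂ) : Prop :=
  ∀ i j, IsTorusSmooth fun k => A k i j

namespace IsTorusSmoothMatrix

lemma mul {A B : Momentum d → Matrix (Fin L) (Fin L) ℂ} (hA : IsTorusSmoothMatrix A)
    (hB : IsTorusSmoothMatrix B) : IsTorusSmoothMatrix fun k => A k * B k := by
  intro i j
  simp only [Matrix.mul_apply]
  exact IsTorusSmooth.sum _ fun l _ => (hA i l).mul (hB l j)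

lemma const (M : Matrix (Fin L) (Fin L) ℂ) : IsTorusSmoothMatrix fun _ : Momentum d => M :=
  fun _ _ => IsTorusSmooth.const _

/-- These matrices are products of factors `(A - λ_l)/(λ_j - λ_l)`, whose denominators vanish
nowhere. -/
lemma aeval_lagrange_basis {ι : Type*} [Fintype ι] [DecidableEq ι]
    {A : Momentum d → Matrix (Fin L) (Fin L) ℂ} (hA : IsTorusSmoothMatrix A)
    {lam : ι → Momentum d → ℝ} (hlam : ∀ j, IsTorusSmooth (lam j))
    (hinj : ∀ k, Function.Injective fun j => lam j k) (j : ι) :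
    IsTorusSmoothMatrix fun k =>
      Polynomial.aeval (A k) (Lagrange.basis Finset.univ (fun i => (lam i k : ℂ)) j) := by
  simp only [Lagrange.basis]
  have key : ∀ s : Finset ι, j ∉ s → IsTorusSmoothMatrix fun k => Polynomial.aeval (A k)
      (∏ l ∈ s, Lagrange.basisDivisor (lam j k : ℂ) (lam l k : ℂ)) := by
    intro s
    induction s using Finset.induction_on with
    | empty =>
      intro _
      simpa using const 1
    | insert a s ha ih =>
      intro hj
      simp only [Finset.prod_insert ha, map_mul]
      refine mul ?_ (ih fun h => hj (Finset.mem_insert_of_mem h))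
      have hne : ∀ k, lam j k - lam a k ≠ 0 := fun k => sub_ne_zero.2 fun h =>
        hj ((hinj k h) ▸ Finset.mem_insert_self a s)
      intro p q
      have h1 : IsTorusSmooth fun k => (((lam j k - lam a k)⁻¹ : ℝ) : ℂ) :=
        IsTorusSmooth.ofReal ⟨((hlam j).smooth.sub (hlam a).smooth).inv hne, fun n k => by
          simp only [(hlam j).periodic n k, (hlam a).periodic n k]⟩
      have h2 : IsTorusSmooth fun k => A k p q + (lam a k : ℂ) * -(1 : Matrix _ _ ℂ) p q :=
        (hA p q).add ((hlam a).ofReal.mul (IsTorusSmooth.const _))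
      convert h1.mul h2 using 2 with k
      simp only [Lagrange.basisDivisor, map_mul, map_sub, Polynomial.aeval_C, Polynomial.aeval_X,
        Algebra.algebraMap_eq_smul_one, Matrix.smul_mul, one_mul, Matrix.smul_apply,
        Matrix.sub_apply, smul_eq_mul]
      push_cast
      ring
  exact key _ (Finset.notMem_erase j _)

end IsTorusSmoothMatrix

section Bands

variable {ℰ : Momentum d → Matrix (Fin L) (Fin L) ℂ}

/-- A repeated eigenvalue comes with two independent vectors of the eigenbasis in one eigenspace. -/
lemma eigenvalues_injective_of_finrank_le_one {A : Matrix (Fin L) (Fin L) ℂ} (hA : A.IsHermitian)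
    (h : ¬∃ μ : ℂ, 2 ≤ Module.finrank ℂ (Module.End.eigenspace (Matrix.toLin' A) μ)) :
    Function.Injective hA.eigenvalues := by
  intro i j hij
  by_contra hne
  refine h ⟨hA.eigenvalues i, ?_⟩
  have hmem : ∀ l, hA.eigenvalues l = hA.eigenvalues i →
      (hA.eigenvectorBasis l).ofLp ∈
        Module.End.eigenspace (Matrix.toLin' A) (hA.eigenvalues i : ℂ) := by
    intro l hl
    rw [Module.End.mem_eigenspace_iff, Matrix.toLin'_apply, hA.mulVec_eigenvectorBasis, hl]
    rfl
  let f : Fin 2 → Module.End.eigenspace (Matrix.toLin' A) (hA.eigenvalues i : ℂ) :=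
    ![⟨_, hmem i rfl⟩, ⟨_, hmem j hij.symm⟩]
  have hf : LinearIndependent ℂ f := by
    refine LinearIndependent.of_comp (Submodule.subtype _) ?_
    have h1 := (hA.eigenvectorBasis.toBasis.linearIndependent.map'
      (WithLp.linearEquiv 2 ℂ (Fin L → ℂ)).toLinearMap (LinearEquiv.ker _)).comp ![i, j]
        (by
          intro a b hab
          fin_cases a <;> fin_cases b <;> simp_all [eq_comm])
    have h2 : (Submodule.subtype _) ∘ f = (⇑(WithLp.linearEquiv 2 ℂ (Fin L → ℂ)).toLinearMap ∘
        ⇑hA.eigenvectorBasis.toBasis) ∘ ![i, j] := by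
      funext a
      fin_cases a <;> simp [f]
    rw [h2]
    exact h1
  simpa using hf.fintype_card_le_finrank

/-- With no band touching, the symbol is diagonalised by globally defined analytic bands with
smooth spectral projections. -/
theorem exists_bands (hE : IsAnalyticSymbol ℰ) (hper : IsPeriodic ℰ)
    (hherm : ∀ k, (ℰ k).IsHermitian) (hW : degeneracySet ℰ = ∅) :
    ∃ (m : ℕ) (lam : Fin m → Momentum d → ℝ)
      (P : Fin m → Momentum d → Matrix (Fin L) (Fin L) ℂ),
      (∀ j, IsTorusSmooth (lam j)) ∧ (∀ j, IsBandOn ℰ univ (lam j)) ∧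
      (∀ j, IsTorusSmoothMatrix (P j)) ∧ ∀ k p, ℰ k ^ p = ∑ j, (lam j k : ℂ) ^ p • P j k := by
  -- Sorted eigenvalues depend on the matrix alone, so they inherit periodicity and cannot be
  -- permuted around the torus.
  let lam : Fin (Fintype.card (Fin L)) → Momentum d → ℝ := fun j k => (hherm k).eigenvalues₀ j
  have hsmooth : ∀ i j, ContDiff ℝ ω fun k => ℰ k i j := fun i j => (hE i j).contDiff
  have hchar : ∀ k, (ℰ k).charpoly = Lagrange.nodal Finset.univ fun j => (lam j k : ℂ) := by
    intro k
    rw [(hherm k).charpoly_eq, Lagrange.nodal_eq]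
    exact Fintype.prod_equiv (Fintype.equivOfCardEq (Fintype.card_fin _)).symm _ _ fun i => rfl
  have hinj : ∀ k, Function.Injective fun j => lam j k := by
    intro k
    have h1 := eigenvalues_injective_of_finrank_le_one (hherm k) fun h => by
      have : k ∈ degeneracySet ℰ := h
      rw [hW] at this
      exact this
    have h2 := h1.comp (Fintype.equivOfCardEq (Fintype.card_fin _) :
      Fin (Fintype.card (Fin L)) ≃ Fin L).injective
    convert h2 using 1
    funext j
    simp [lam, Matrix.IsHermitian.eigenvalues]
  have hanti : ∀ k, StrictAnti fun j => lam j k := fun k =>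
    (hherm k).eigenvalues₀_antitone.strictAnti_of_injective (hinj k)
  have hana : ∀ j, AnalyticOnNhd ℝ (lam j) univ := by
    intro j k _
    have hdet : ContDiff ℝ ω fun p : Momentum d × ℝ =>
        (Matrix.scalar (Fin L) (p.2 : ℂ) - ℰ p.1).det := by
      simp only [Matrix.det_apply]
      refine ContDiff.sum fun τ _ => ContDiff.const_smul _ (contDiff_prod fun i _ => ?_)
      simp only [Matrix.sub_apply, Matrix.scalar_apply, Matrix.diagonal_apply]
      refine ContDiff.sub ?_ ((hsmooth _ _).comp contDiff_fst)
      split_ifs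
      · exact Complex.ofRealCLM.contDiff.comp contDiff_snd
      · exact contDiff_const
    refine analyticAt_of_eq_prod (F := fun p => ((Matrix.scalar (Fin L) (p.2 : ℂ) - ℰ p.1).det).re)
      hanti (Complex.reCLM.contDiff.comp hdet) (fun k x => ?_) j k
    rw [← Matrix.eval_charpoly, hchar, Lagrange.eval_nodal]
    simp only [← Complex.ofReal_sub, ← Complex.ofReal_prod, Complex.ofReal_re]
  have hlam : ∀ j, IsTorusSmooth (lam j) := fun j => by
    refine ⟨(hana j).contDiff, fun n k => ?_⟩
    have : ∀ (A B : Matrix (Fin L) (Fin L) ℂ) (hA : A.IsHermitian) (hB : B.IsHermitian), A = B →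
        hA.eigenvalues₀ j = hB.eigenvalues₀ j := by
      rintro A _ hA hB rfl
      rfl
    exact this _ _ _ _ (hper n k)
  have hEs : IsTorusSmoothMatrix ℰ := fun i j =>
    ⟨(hE i j).contDiff, fun n k => by simp only [hper n k]⟩
  refine ⟨_, lam, fun j k =>
    Polynomial.aeval (ℰ k) (Lagrange.basis Finset.univ (fun i => (lam i k : ℂ)) j), hlam,
    fun j => ⟨hana j, fun k _ => ?_⟩, fun j => hEs.aeval_lagrange_basis hlam hinj j,
    fun k p => pow_eq_sum_smul_aeval_basis (Complex.ofReal_injective.comp (hinj k)) (hchar k) p⟩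
  rw [Module.End.hasEigenvalue_iff_mem_spectrum, Matrix.spectrum_toLin',
    Matrix.mem_spectrum_iff_isRoot_charpoly, hchar, Polynomial.IsRoot]
  exact Lagrange.eval_nodal_at_node (v := fun i => (lam i k : ℂ)) (Finset.mem_univ j)

end Bands

end BlochLAP

end

/-! ### Fourier inversion, and properties of the symbol read off from `H`. -/

noncomputable section

namespace BlochLAP

open MeasureTheory Set
open scoped ContDiff

variable {d L : ℕ}

/-- The character `k ↦ exp(ik·n)` of the torus. -/
def character (n : Fin d → ℤ) (k : Momentum d) : ℂ :=
  Complex.exp (Complex.I * ((∑ i, k i * (n i : ℝ) : ℝ) : ℂ))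

/-- The normalising constant `(2π)^{-d/2}` of the Fourier transform. -/
def fourierConst (d : ℕ) : ℂ := (((2 * Real.pi) ^ (-(d : ℝ) / 2) : ℝ) : ℂ)

lemma fourierConst_ne_zero (d : ℕ) : fourierConst d ≠ 0 :=
  Complex.ofReal_ne_zero.2 (Real.rpow_pos_of_pos Real.two_pi_pos _).ne'

lemma fourierConst_mul_self (d : ℕ) :
    fourierConst d * fourierConst d * (((2 * Real.pi) ^ d : ℝ) : ℂ) = 1 := by
  have hpi := Real.two_pi_pos
  rw [fourierConst, ← Complex.ofReal_mul, ← Complex.ofReal_mul, ← Real.rpow_natCast,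
    ← Real.rpow_add hpi, ← Real.rpow_add hpi, ← Complex.ofReal_one]
  congr 1
  rw [show -(d : ℝ) / 2 + -(d : ℝ) / 2 + (d : ℝ) = 0 by ring, Real.rpow_zero]

lemma norm_character (n : Fin d → ℤ) (k : Momentum d) : ‖character n k‖ = 1 := by
  rw [character, Complex.norm_exp]
  simp

lemma continuous_character (n : Fin d → ℤ) : Continuous (character n) := by
  unfold character
  fun_prop

lemma character_add (n m : Fin d → ℤ) (k : Momentum d) :
    character (n + m) k = character n k * character m k := by
  rw [character, character, character, ← Complex.exp_add, ← mul_add, ← Complex.ofReal_add,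
    ← Finset.sum_add_distrib]
  congr 3
  refine Finset.sum_congr rfl fun i _ => ?_
  simp [mul_add]

lemma character_neg (n : Fin d → ℤ) (k : Momentum d) :
    character (-n) k = Complex.exp (-Complex.I * ((∑ i, k i * (n i : ℝ) : ℝ) : ℂ)) := by
  rw [character]
  congr 1
  simp

lemma conj_character (n : Fin d → ℤ) (k : Momentum d) :
    (starRingEnd ℂ) (character n k) = character (-n) k := by
  rw [character_neg, character, ← Complex.exp_conj]
  simp

lemma character_add_period (n m : Fin d → ℤ) (k : Momentum d) :
    character n (k + period m) = character n k := by
  refine Complex.exp_eq_exp_iff_exists_int.2 ⟨∑ i, m i * n i, ?_⟩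
  simp only [PiLp.add_apply, period_apply]
  push_cast
  simp only [add_mul, Finset.sum_add_distrib, mul_add, Finset.mul_sum, Finset.sum_mul]
  congr 1
  refine Finset.sum_congr rfl fun i _ => by ring

lemma hasFourierTransform_iff {φ : Hilb d L} {f : Momentum d → Fibre L} :
    HasFourierTransform φ f ↔
      ∀ k, HasSum (fun n => (fourierConst d * character (-n) k) • φ n) (f k) := by
  simp only [character_neg]
  rfl

lemma character_eq_wave (n : Fin d → ℤ) :
    character n = wave (fun _ => 0) 1 (WithLp.toLp 2 fun i => (n i : ℝ)) := by
  funext k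
  rw [character, wave]
  congr 1
  simp

lemma volume_real_cell : volume.real (cell d) = (2 * Real.pi) ^ d := by
  have h := setIntegral_cell (d := d) fun _ => (1 : ℝ)
  rw [setIntegral_const, setIntegral_const, smul_eq_mul, smul_eq_mul, mul_one, mul_one] at h
  have h1 := Real.volume_Icc_pi_toReal (a := fun _ : Fin d => (0 : ℝ)) (b := fun _ => 2 * Real.pi)
    (fun _ => Real.two_pi_pos.le)
  rw [h]
  exact h1.trans (by simp)

/-- A character is the wave of the zero band at `t = 1`. If `n j ≠ 0` it is a multiple of its own
`j`-th derivative, whose integral vanishes. -/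
lemma integral_cell_character (n : Fin d → ℤ) :
    ∫ k in cell d, character n k = if n = 0 then (((2 * Real.pi) ^ d : ℝ) : ℂ) else 0 := by
  split_ifs with h
  · subst h
    simp only [character, Pi.zero_apply, Int.cast_zero, mul_zero, Finset.sum_const_zero,
      Complex.ofReal_zero, Complex.exp_zero]
    rw [setIntegral_const, volume_real_cell]
    simp
  · obtain ⟨j, hj⟩ := Function.ne_iff.1 h
    have h0 : IsTorusSmooth fun _ : Momentum d => (0 : ℝ) := IsTorusSmooth.const 0
    have hs := isTorusSmooth_wave h0 (t := 1) (v := WithLp.toLp 2 fun i => (n i : ℝ)) (n := n)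
      (fun i => one_mul _)
    have h1 := integral_cell_pderiv_eq_zero (hs.smooth.of_le (by norm_cast)) hs.periodic j
    simp only [pderiv_wave h0] at h1
    have hsl : ∀ k, slope (fun _ => (0 : ℝ)) (WithLp.toLp 2 fun i => (n i : ℝ)) j k = -n j := by
      intro k
      simp [slope, pderiv]
    simp only [hsl] at h1
    rw [integral_const_mul, ← character_eq_wave] at h1
    refine (mul_eq_zero.1 h1).resolve_left ?_
    have : (n j : ℂ) ≠ 0 := by exact_mod_cast hj
    simp [this]

/-- Fourier inversion for absolutely convergent Fourier series. -/
lemma HasFourierTransform.inversion {φ : Hilb d L} {f : Momentum d → Fibre L}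
    (h : HasFourierTransform φ f) (n : Fin d → ℤ) (a : Fin L) :
    φ n a = fourierConst d * ∫ k in cell d, character n k * f k a := by
  rw [hasFourierTransform_iff] at h
  -- Convergence at `k = 0` already says that `φ` is `ℓ¹`, which dominates the series at every `k`.
  have hsum : Summable fun m => ‖fourierConst d‖ * ‖φ m‖ := by
    refine (summable_norm_iff.2 (h 0).summable).congr fun m => ?_
    rw [norm_smul, norm_mul, norm_character, mul_one]
  have hcoord : ∀ k, HasSum (fun m => fourierConst d * character (n - m) k * φ m a)
      (character n k * f k a) := by
    intro k
    have h1 := ((EuclideanSpace.proj (𝕜 := ℂ) a).hasSum (h k)).mul_left (character n k)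
    refine h1.congr_fun fun m => ?_
    simp only [PiLp.proj_apply, PiLp.smul_apply, smul_eq_mul, sub_eq_add_neg, character_add]
    ring
  have h2 : HasSum (fun m => ∫ k in cell d, fourierConst d * character (n - m) k * φ m a)
      (∫ k in cell d, character n k * f k a) := by
    refine hasSum_integral_of_dominated_convergence (fun m _ => ‖fourierConst d‖ * ‖φ m‖)
      (fun m => ?_) (fun m => Eventually.of_forall fun k => ?_)
      (Eventually.of_forall fun k => hsum) ?_ (Eventually.of_forall hcoord)
    · exact ((continuous_const.mul (continuous_character _)).mul
        continuous_const).aestronglyMeasurable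
    · rw [norm_mul, norm_mul, norm_character, mul_one]
      gcongr
      exact PiLp.norm_apply_le _ _
    · exact Continuous.integrableOn_cell continuous_const
  have h3 : ∀ m, ∫ k in cell d, fourierConst d * character (n - m) k * φ m a =
      if m = n then fourierConst d * (((2 * Real.pi) ^ d : ℝ) : ℂ) * φ n a else 0 := by
    intro m
    simp only [mul_assoc]
    rw [integral_const_mul, integral_mul_const, integral_cell_character]
    by_cases hm : m = n
    · simp [hm]
    · simp [hm, sub_eq_zero, Ne.symm hm]
  simp only [h3] at h2
  rw [h2.unique (hasSum_ite_eq n _)]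
  linear_combination (-φ n a) * fourierConst_mul_self d

section Symbol

variable {H : Op d L} {ℰ : Momentum d → Matrix (Fin L) (Fin L) ℂ}

lemma hasFourierTransform_single (m : Fin d → ℤ) (v : Fibre L) :
    HasFourierTransform (lp.single 2 m v : Hilb d L)
      (fun k => (fourierConst d * character (-m) k) • v) := by
  rw [hasFourierTransform_iff]
  intro k
  have h := hasSum_single (f := fun n => (fourierConst d * character (-n) k) •
    (lp.single 2 m v : Hilb d L) n) m fun n hn => by
      rw [lp.single_apply_ne _ _ _ hn, smul_zero]
  simpa [lp.single_apply_self] using h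

lemma IsSymbol.hasFourierTransform_pow (hH : IsSymbol H ℰ) (p : ℕ) {φ : Hilb d L}
    {f : Momentum d → Fibre L} (hφ : HasFourierTransform φ f) :
    HasFourierTransform ((H ^ p) φ)
      (fun k => Matrix.toEuclideanCLM (𝕜 := ℂ) (ℰ k ^ p) (f k)) := by
  induction p with
  | zero => simpa using hφ
  | succ p ih =>
    have h := hH _ _ ih
    simp only [pow_succ', map_mul]
    exact h

lemma toEuclideanCLM_apply (A : Matrix (Fin L) (Fin L) ℂ) (v : Fibre L) (a : Fin L) :
    Matrix.toEuclideanCLM (𝕜 := ℂ) A v a = ∑ b, A a b * v b := by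
  rw [Matrix.ofLp_toEuclideanCLM]
  rfl

/-- Obtained by testing the symbol on delta functions at the origin. Periodicity and hermiticity of
`ℰ`, which `IsSymbol` does not mention, are deduced from this series. -/
lemma IsSymbol.hasSum_entry (hH : IsSymbol H ℰ) (k : Momentum d) (a b : Fin L) :
    HasSum (fun n => character (-n) k *
      matrixElement H n 0 (EuclideanSpace.single b 1) a) (ℰ k a b) := by
  have h := (hasFourierTransform_iff.1 (hH _ _ (hasFourierTransform_single 0
    (EuclideanSpace.single b (1 : ℂ))))) k
  have h1 := ((EuclideanSpace.proj (𝕜 := ℂ) a).hasSum h).mul_left (fourierConst d)⁻¹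
  have h0 : character (0 : Fin d → ℤ) k = 1 := by simp [character]
  have hc := fourierConst_ne_zero d
  have hval : (fourierConst d)⁻¹ * (EuclideanSpace.proj (𝕜 := ℂ) a)
      (Matrix.toEuclideanCLM (𝕜 := ℂ) (ℰ k)
        ((fourierConst d * character (-0) k) • EuclideanSpace.single b (1 : ℂ))) = ℰ k a b := by
    rw [PiLp.proj_apply, toEuclideanCLM_apply, Finset.sum_eq_single b]
    · simp only [neg_zero, h0, PiLp.smul_apply, smul_eq_mul, PiLp.single_apply]
      simp only [if_true]
      field_simp
    · intro c _ hcb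
      simp [hcb]
    · simp
  refine (hval ▸ h1).congr_fun fun n => ?_
  simp only [PiLp.proj_apply, PiLp.smul_apply, smul_eq_mul, matrixElement]
  field_simp

lemma IsSymbol.periodic (hH : IsSymbol H ℰ) : IsPeriodic ℰ := by
  intro m k
  ext a b
  have h1 := hH.hasSum_entry (k + period m) a b
  simp only [character_add_period] at h1
  exact h1.unique (hH.hasSum_entry k a b)

lemma inner_single_left (n : Fin d → ℤ) (v : Fibre L) (φ : Hilb d L) :
    inner ℂ (lp.single 2 n v : Hilb d L) φ = inner ℂ v (φ n) :=
  lp.inner_single_left (𝕜 := ℂ) (G := fun _ : Fin d → ℤ => Fibre L) n v φ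

lemma inner_single_right (n : Fin d → ℤ) (v : Fibre L) (φ : Hilb d L) :
    inner ℂ φ (lp.single 2 n v : Hilb d L) = inner ℂ (φ n) v :=
  lp.inner_single_right (𝕜 := ℂ) (G := fun _ : Fin d → ℤ => Fibre L) n v φ

lemma matrixElement_swap (hS : IsSelfAdjoint H) (n m : Fin d → ℤ) (u v : Fibre L) :
    inner ℂ u (matrixElement H n m v) = inner ℂ (matrixElement H m n u) v := by
  rw [matrixElement, matrixElement, ← inner_single_left, ← inner_single_right]
  exact (hS.isSymmetric _ _).symm

/-- Conjugate the series of one entry and reflect `n` in that of the transposed entry: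
self-adjointness exchanges the two sites, and translation invariance moves the origin back. -/
lemma IsSymbol.isHermitian (hH : IsSymbol H ℰ) (hS : IsSelfAdjoint H)
    (hT : TranslationInvariant H) (k : Momentum d) : (ℰ k).IsHermitian := by
  ext a b
  rw [Matrix.conjTranspose_apply]
  have h1 := (Complex.conjCLE.toContinuousLinearMap.hasSum (hH.hasSum_entry k b a))
  have h2 := (Equiv.neg (Fin d → ℤ)).hasSum_iff.2 (hH.hasSum_entry k a b)
  refine h1.unique (h2.congr_fun fun n => ?_)
  simp only [Function.comp_apply, Equiv.neg_apply, neg_neg, ContinuousLinearEquiv.coe_coe,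
    Complex.conjCLE_apply, map_mul, conj_character]
  congr 1
  have h3 := matrixElement_swap hS (-n) 0 (EuclideanSpace.single a 1) (EuclideanSpace.single b 1)
  rw [EuclideanSpace.inner_single_left, EuclideanSpace.inner_single_right] at h3
  have h4 := congrFun (hT 0 (-n) n) (EuclideanSpace.single a 1)
  rw [zero_add, neg_add_cancel] at h4
  rw [← h4] at h3
  simpa using h3.symm

end Symbol

end BlochLAP

end

/-! ### The propagator and the decay of its kernel inside a cone. -/

noncomputable section

namespace BlochLAP

open MeasureTheory Set
open scoped ContDiff

variable {d L : ℕ}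

/-- The unitary group `exp(-itH)`. -/
def propagator (H : Op d L) (t : ℝ) : Op d L := NormedSpace.exp (t • (-Complex.I • H))

/-- Termwise integration of the exponential series. -/
lemma hasSum_integral_cell_exp_mul {lam : Momentum d → ℝ} (hlam : Continuous lam)
    {Q : Momentum d → ℂ} (hQ : Continuous Q) (z : ℂ) :
    HasSum (fun p : ℕ => (z ^ p / (Nat.factorial p : ℂ)) * ∫ k in cell d, (lam k : ℂ) ^ p * Q k)
      (∫ k in cell d, Complex.exp (z * lam k) * Q k) := by
  obtain ⟨Λ, hΛ⟩ := isCompact_cell.exists_bound_of_continuousOn (s := cell d) hlam.continuousOn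
  obtain ⟨C, hC⟩ := isCompact_cell.exists_bound_of_continuousOn (s := cell d) hQ.continuousOn
  simp only [← integral_const_mul]
  refine hasSum_integral_of_dominated_convergence
    (fun p _ => (‖z‖ * Λ) ^ p / (Nat.factorial p : ℝ) * C) (fun p => ?_) (fun p => ?_) ?_ ?_ ?_
  · exact (continuous_const.mul (((Complex.continuous_ofReal.comp hlam).pow p).mul
      hQ)).aestronglyMeasurable
  · refine (ae_restrict_iff' measurableSet_cell).2 (Eventually.of_forall fun k hk => ?_)
    rw [norm_mul, norm_mul, norm_div, norm_pow, norm_pow, Complex.norm_natCast, Complex.norm_real,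
      mul_pow, ← mul_assoc, mul_div_right_comm]
    have h1 := hΛ k hk
    have h2 := hC k hk
    have h3 : 0 ≤ Λ := (norm_nonneg _).trans h1
    gcongr
  · exact Eventually.of_forall fun k => (Real.summable_pow_div_factorial _).mul_right C
  · exact Continuous.integrableOn_cell continuous_const
  · refine Eventually.of_forall fun k => ?_
    have h := (NormedSpace.expSeries_div_hasSum_exp (z * lam k)).mul_right (Q k)
    rw [← Complex.exp_eq_exp_ℂ] at h
    refine h.congr_fun fun p => ?_
    rw [mul_pow]
    ring

section Kernel

variable {H : Op d L} {ℰ : Momentum d → Matrix (Fin L) (Fin L) ℂ} {m : ℕ}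
  {lam : Fin m → Momentum d → ℝ} {P : Fin m → Momentum d → Matrix (Fin L) (Fin L) ℂ}

/-- Powers of `H` preserve the vectors with convergent Fourier series, so inversion gives their
kernels without extending the Fourier transform to `ℓ²`. -/
lemma IsSymbol.pow_apply (hH : IsSymbol H ℰ) (hlam : ∀ j, IsTorusSmooth (lam j))
    (hP : ∀ j, IsTorusSmoothMatrix (P j))
    (hdec : ∀ k p, ℰ k ^ p = ∑ j, (lam j k : ℂ) ^ p • P j k) (p : ℕ) (n n' : Fin d → ℤ)
    (v : Fibre L) (a : Fin L) :
    ((H ^ p) (lp.single 2 n' v)) n a = fourierConst d ^ 2 * ∑ j, ∑ b, v b *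
      ∫ k in cell d, (lam j k : ℂ) ^ p * (P j k a b * character (n - n') k) := by
  rw [(hH.hasFourierTransform_pow p (hasFourierTransform_single n' v)).inversion n a]
  have e : ∀ k, character n k * Matrix.toEuclideanCLM (𝕜 := ℂ) (ℰ k ^ p)
      ((fourierConst d * character (-n') k) • v) a =
      ∑ j, ∑ b, fourierConst d * v b *
        ((lam j k : ℂ) ^ p * (P j k a b * character (n - n') k)) := by
    intro k
    rw [toEuclideanCLM_apply, hdec, Finset.sum_comm, Finset.mul_sum]
    refine Finset.sum_congr rfl fun b _ => ?_
    rw [Matrix.sum_apply, Finset.sum_mul, Finset.mul_sum]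
    refine Finset.sum_congr rfl fun j _ => ?_
    simp only [Matrix.smul_apply, PiLp.smul_apply, smul_eq_mul, sub_eq_add_neg, character_add]
    ring
  simp only [e]
  have hint : ∀ j b, IntegrableOn (fun k => fourierConst d * v b *
      ((lam j k : ℂ) ^ p * (P j k a b * character (n - n') k))) (cell d) := fun j b =>
    Continuous.integrableOn_cell (continuous_const.mul
      (((hlam j).ofReal.smooth.continuous.pow p).mul
        ((hP j a b).smooth.continuous.mul (continuous_character _))))
  rw [integral_finsetSum _ fun j _ => integrable_finsetSum _ fun b _ => hint j b, Finset.mul_sum,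
    Finset.mul_sum]
  refine Finset.sum_congr rfl fun j _ => ?_
  rw [integral_finsetSum _ fun b _ => hint j b, Finset.mul_sum, Finset.mul_sum]
  refine Finset.sum_congr rfl fun b _ => ?_
  rw [integral_const_mul]
  ring

/-- Evaluating one component at one site is a continuous functional of the operator; applied to the
exponential series it reduces the kernel to those of the powers, resummed under the integral. -/
lemma IsSymbol.propagator_apply (hH : IsSymbol H ℰ) (hlam : ∀ j, IsTorusSmooth (lam j))
    (hP : ∀ j, IsTorusSmoothMatrix (P j))
    (hdec : ∀ k p, ℰ k ^ p = ∑ j, (lam j k : ℂ) ^ p • P j k) (t : ℝ) (n n' : Fin d → ℤ)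
    (v : Fibre L) (a : Fin L) :
    (propagator H t (lp.single 2 n' v)) n a = fourierConst d ^ 2 * ∑ j, ∑ b, v b *
      ∫ k in cell d, P j k a b *
        Complex.exp (-Complex.I * ((t * lam j k - ∑ i, k i * (n - n') i : ℝ) : ℂ)) := by
  set z : ℂ := t * -Complex.I with hz
  have hzH : t • (-Complex.I • H) = z • H := by
    rw [hz, mul_smul]
    exact (RCLike.real_smul_eq_coe_smul (K := ℂ) t _)
  have h1 := NormedSpace.exp_series_hasSum_exp' (𝕂 := ℂ) (z • H)
  let ev : Op d L →L[ℂ] ℂ := (EuclideanSpace.proj (𝕜 := ℂ) a ∘L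
    lp.evalCLM ℂ (fun _ : Fin d → ℤ => Fibre L) 2 n) ∘L
      ContinuousLinearMap.apply ℂ (Hilb d L) (lp.single 2 n' v)
  have hev : ∀ A : Op d L, ev A = (A (lp.single 2 n' v)) n a := fun A => rfl
  have h2 := ev.hasSum h1
  rw [hev, ← hzH, ← propagator] at h2
  refine h2.unique ?_
  have h3 : HasSum (fun p : ℕ => fourierConst d ^ 2 * ∑ j, ∑ b, v b *
      ((z ^ p / (Nat.factorial p : ℂ)) *
        ∫ k in cell d, (lam j k : ℂ) ^ p * (P j k a b * character (n - n') k)))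
      (fourierConst d ^ 2 * ∑ j, ∑ b, v b *
        ∫ k in cell d, Complex.exp (z * lam j k) * (P j k a b * character (n - n') k)) :=
    (hasSum_sum fun j _ => hasSum_sum fun b _ => (hasSum_integral_cell_exp_mul
      (hlam j).smooth.continuous ((hP j a b).smooth.continuous.mul
        (continuous_character _)) z).mul_left _).mul_left _
  have h4 : ∀ j k b, Complex.exp (z * lam j k) * (P j k a b * character (n - n') k) =
      P j k a b * Complex.exp (-Complex.I * ((t * lam j k - ∑ i, k i * (n - n') i : ℝ) : ℂ)) := by
    intro j k b
    rw [mul_left_comm, character, ← Complex.exp_add]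
    congr 2
    rw [hz]
    push_cast
    ring
  simp only [← h4]
  refine h3.congr_fun fun p => ?_
  rw [hzH, smul_pow, map_smul, map_smul, hev, hH.pow_apply hlam hP hdec]
  simp only [smul_eq_mul, Finset.mul_sum]
  refine Finset.sum_congr rfl fun j _ => Finset.sum_congr rfl fun b _ => ?_
  field_simp

/-- The Euclidean length of a lattice vector. -/
def latticeNorm (n : Fin d → ℤ) : ℝ := ‖(WithLp.toLp 2 fun i => (n i : ℝ) : Momentum d)‖

/-- Uniform decay of the kernel of the propagator inside a cone. -/
theorem exists_norm_propagator_single_le (hS : IsSelfAdjoint H)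
    (hT : TranslationInvariant H) (hH : IsSymbol H ℰ) (hE : IsAnalyticSymbol ℰ)
    (hW : degeneracySet ℰ = ∅) (hM : AllBandsMorse ℰ) :
    ∃ C c : ℝ, 0 ≤ C ∧ 0 < c ∧ ∀ (t : ℝ) (n n' : Fin d → ℤ) (v : Fibre L), 1 ≤ t →
      latticeNorm (n - n') ≤ c * t →
        ‖(propagator H t (lp.single 2 n' v)) n‖ ≤ C * t ^ (-(d : ℝ) / 2) * ‖v‖ := by
  obtain ⟨m, lam, P, hlam, hband, hP, hdec⟩ :=
    exists_bands hE hH.periodic (hH.isHermitian hS hT) hW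
  have hmorse : ∀ j k, gradient (lam j) k = 0 → (hessian (lam j) k).det ≠ 0 := fun j k =>
    hM univ (lam j) isOpen_univ (by rw [hW]; exact disjoint_bot_right) (hband j) k (mem_univ k)
  choose C c hC hc h using fun (q : Fin m × Fin L × Fin L) =>
    exists_norm_integral_cell_le_of_morse (hlam q.1) (hmorse q.1) (hP q.1 q.2.1 q.2.2)
  -- One cone for the finitely many bands and matrix entries; without entries any aperture will do.
  obtain ⟨c₀, hc₀, hcle⟩ : ∃ c₀ > 0, ∀ q, c₀ ≤ c q := by
    obtain hq | hq := isEmpty_or_nonempty (Fin m × Fin L × Fin L)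
    · exact ⟨1, one_pos, fun q => (hq.false q).elim⟩
    · obtain ⟨q₀, hq₀⟩ := Finite.exists_min c
      exact ⟨c q₀, hc q₀, hq₀⟩
  refine ⟨‖fourierConst d ^ 2‖ * ∑ a, ∑ j, ∑ b, C (j, a, b), c₀,
    mul_nonneg (norm_nonneg _) (Finset.sum_nonneg fun a _ => Finset.sum_nonneg fun j _ =>
      Finset.sum_nonneg fun b _ => hC _), hc₀, fun t n n' v ht hn => ?_⟩
  have hnorm : ∀ w : Fibre L, ‖w‖ ≤ ∑ a, ‖w a‖ := fun w => by
    rw [EuclideanSpace.norm_eq]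
    exact Real.sqrt_le_iff.2 ⟨Finset.sum_nonneg fun _ _ => norm_nonneg _,
      Finset.sum_sq_le_sq_sum_of_nonneg fun _ _ => norm_nonneg _⟩
  refine (hnorm _).trans ?_
  rw [Finset.mul_sum, Finset.sum_mul, Finset.sum_mul]
  refine Finset.sum_le_sum fun a _ => ?_
  rw [hH.propagator_apply hlam hP hdec, norm_mul, mul_assoc, mul_assoc]
  gcongr
  rw [Finset.sum_mul]
  refine (norm_sum_le _ _).trans (Finset.sum_le_sum fun j _ => ?_)
  rw [Finset.sum_mul]
  refine (norm_sum_le _ _).trans (Finset.sum_le_sum fun b _ => ?_)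
  rw [norm_mul, ← mul_assoc, mul_comm]
  refine mul_le_mul (h (j, a, b) t (n - n') ht (hn.trans ?_)) (PiLp.norm_apply_le v b)
    (norm_nonneg _) (mul_nonneg (hC _) (Real.rpow_nonneg (by linarith) _))
  have := hcle (j, a, b)
  gcongr

end Kernel

lemma propagator_mem_unitary {H : Op d L} (hS : IsSelfAdjoint H) (t : ℝ) :
    propagator H t ∈ unitary (Op d L) := by
  let +nondep : NormedAlgebra ℚ (Op d L) := .restrictScalars ℚ ℂ (Op d L)
  refine NormedSpace.exp_mem_unitary_of_mem_skewAdjoint ?_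
  rw [skewAdjoint.mem_iff, RCLike.real_smul_eq_coe_smul (K := ℂ) t, star_smul, star_smul,
    hS.star_eq]
  simp

lemma norm_propagator_le_one {H : Op d L} (hS : IsSelfAdjoint H) (t : ℝ) :
    ‖propagator H t‖ ≤ 1 := by
  rw [← mul_one (propagator H t), CStarRing.norm_mem_unitary_mul _ (propagator_mem_unitary hS t)]
  exact ContinuousLinearMap.norm_id_le

end BlochLAP

end

/-! ### From kernel decay to decay of the weighted propagator. -/

noncomputable section

namespace BlochLAP

open MeasureTheory Set
open scoped ContDiff

variable {d L : ℕ}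

section LatticeSums

lemma latticeNorm_sq (n : Fin d → ℤ) : latticeNorm n ^ 2 = ∑ i, (n i : ℝ) ^ 2 := by
  rw [latticeNorm, EuclideanSpace.norm_sq_eq]
  simp

lemma latticeNorm_nonneg (n : Fin d → ℤ) : 0 ≤ latticeNorm n := norm_nonneg _

lemma latticeNorm_sub_le (n m : Fin d → ℤ) :
    latticeNorm (n - m) ≤ latticeNorm n + latticeNorm m := by
  refine le_trans (le_of_eq ?_) (norm_sub_le _ _)
  rw [latticeNorm, ← WithLp.toLp_sub]
  congr 2
  funext i
  simp

lemma weight_eq (α : ℝ≥0) (n : Fin d → ℤ) :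
    weight α n = (1 + latticeNorm n ^ 2) ^ (-(α : ℝ) / 2) := by
  rw [weight, latticeNorm_sq]

/-- Comparison with `∑ |x|^{-2s}` over a lattice of full rank. -/
lemma summable_one_add_latticeNorm_sq_rpow {s : ℝ} (hs : (d : ℝ) / 2 < s) :
    Summable fun n : Fin d → ℤ => (1 + latticeNorm n ^ 2) ^ (-s) := by
  let b := (EuclideanSpace.basisFun (Fin d) ℝ).toBasis
  let Λ := Submodule.span ℤ (range b)
  have hrank : Module.finrank ℤ Λ = d := by
    rw [ZLattice.rank ℝ Λ, finrank_euclideanSpace_fin]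
  have h1 := ZLattice.summable_norm_rpow Λ (-(2 * s)) (by rw [hrank]; linarith)
  have hmem : ∀ n : Fin d → ℤ, (WithLp.toLp 2 fun i => (n i : ℝ) : Momentum d) ∈ Λ := by
    intro n
    have : (WithLp.toLp 2 fun i => (n i : ℝ) : Momentum d) = ∑ i, n i • b i := by
      ext j
      simp [b, Pi.single_apply]
    rw [this]
    exact Submodule.sum_mem _ fun i _ => Submodule.smul_mem _ _ (Submodule.subset_span ⟨i, rfl⟩)
  let g : (Fin d → ℤ) → Λ := fun n => ⟨_, hmem n⟩
  have hg : Function.Injective g := by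
    intro n m h
    funext i
    have h2 : (n i : ℝ) = m i := congrArg (fun x : Λ => (x : Momentum d) i) h
    exact_mod_cast h2
  refine (h1.comp_injective hg).of_norm_bounded_eventually ?_
  -- The origin is excepted from the comparison: there `0 ^ (-(2 * s))` is `0` and dominates
  -- nothing.
  refine (Set.finite_singleton (0 : Fin d → ℤ)).subset fun n hn => ?_
  by_contra hne
  refine hn ?_
  have hpos : 0 < latticeNorm n := by
    refine norm_pos_iff.2 fun h => hne ?_
    refine Set.mem_singleton_iff.2 (funext fun i => ?_)
    have := congrArg (fun x : Momentum d => x i) h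
    simpa using this
  have hd0 : (0 : ℝ) ≤ d := d.cast_nonneg
  change ‖(1 + latticeNorm n ^ 2) ^ (-s)‖ ≤ latticeNorm n ^ (-(2 * s))
  rw [Real.norm_of_nonneg (by positivity), ← mul_neg, Real.rpow_mul hpos.le, Real.rpow_two]
  exact Real.rpow_le_rpow_of_nonpos (by positivity) (by linarith) (by linarith)

end LatticeSums

section DiagOp

variable {f : (Fin d → ℤ) → ℝ}

lemma norm_diag_smul_le {M : ℝ} (hf : ∀ n, |f n| ≤ M) (φ : Hilb d L) (n : Fin d → ℤ) :
    ‖((f n : ℝ) : ℂ) • φ n‖ ≤ ‖((M : ℂ) • φ) n‖ := by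
  have hM : 0 ≤ M := (abs_nonneg _).trans (hf n)
  rw [lp.coeFn_smul, Pi.smul_apply, norm_smul, norm_smul, Complex.norm_real, Complex.norm_real,
    Real.norm_of_nonneg hM]
  exact mul_le_mul_of_nonneg_right (hf n) (norm_nonneg _)

/-- Multiplication by a bounded real function on the lattice. -/
def diagOp (L : ℕ) {M : ℝ} (hf : ∀ n, |f n| ≤ M) : Op d L :=
  LinearMap.mkContinuous
    { toFun := fun φ =>
        (⟨fun n => ((f n : ℝ) : ℂ) • φ n,
          (lp.memℓp ((M : ℂ) • φ)).mono' (norm_diag_smul_le hf φ)⟩ : Hilb d L)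
      map_add' := fun φ ψ => by
        ext1
        funext n
        exact smul_add _ _ _
      map_smul' := fun c φ => by
        ext1
        funext n
        exact smul_comm ((f n : ℝ) : ℂ) c (φ n) }
    M (fun φ => by
      have hM : 0 ≤ M := (abs_nonneg _).trans (hf 0)
      refine (lp.norm_mono (y := (M : ℂ) • φ) two_ne_zero (norm_diag_smul_le hf φ)).trans
        (le_of_eq ?_)
      rw [norm_smul, Complex.norm_real, Real.norm_of_nonneg hM])

lemma diagOp_apply {M : ℝ} (hf : ∀ n, |f n| ≤ M) (φ : Hilb d L) (n : Fin d → ℤ) :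
    diagOp L hf φ n = ((f n : ℝ) : ℂ) • φ n := rfl

lemma norm_diagOp_le {M : ℝ} (hf : ∀ n, |f n| ≤ M) : ‖(diagOp L hf : Op d L)‖ ≤ M :=
  LinearMap.mkContinuous_norm_le _ ((abs_nonneg _).trans (hf 0)) _

/-- A Hilbert–Schmidt type bound for an operator with bounded kernel between square-summable
weights. -/
lemma norm_diagOp_mul_mul_diagOp_le {M : ℝ} (hf : ∀ n, |f n| ≤ M) {A : Op d L} {B S : ℝ}
    (hB : 0 ≤ B) (hA : ∀ n m, f n ≠ 0 → f m ≠ 0 → ∀ v, ‖(A (lp.single 2 m v)) n‖ ≤ B * ‖v‖)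
    (hS : ∀ s : Finset (Fin d → ℤ), ∑ n ∈ s, f n ^ 2 ≤ S) :
    ‖diagOp L hf * A * diagOp L hf‖ ≤ B * S := by
  have hS0 : 0 ≤ S := by simpa using hS ∅
  refine ContinuousLinearMap.opNorm_le_bound _ (mul_nonneg hB hS0) fun φ => ?_
  have htwo : (2 : ENNReal).toReal = 2 := by norm_num
  have hφ : ∀ s : Finset (Fin d → ℤ), ∑ n ∈ s, ‖φ n‖ ^ 2 ≤ ‖φ‖ ^ 2 := fun s => by
    have h := lp.sum_rpow_le_norm_rpow (p := 2) (by norm_num) φ s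
    rw [htwo] at h
    exact_mod_cast h
  set K := B * (√S * ‖φ‖) with hK
  have hK0 : 0 ≤ K := by positivity
  -- Cauchy–Schwarz over the input sites gives one factor `√S`; summing `f n ^ 2 * K ^ 2` over the
  -- output sites gives the other.
  have hpt : ∀ n, f n ≠ 0 → ‖(A (diagOp L hf φ)) n‖ ≤ K := by
    intro n hn
    have h1 := (lp.evalCLM ℂ (fun _ : Fin d → ℤ => Fibre L) 2 n ∘L A).hasSum
      (lp.hasSum_single (by norm_num) (diagOp L hf φ))
    refine le_of_tendsto h1.norm (Eventually.of_forall fun s => ?_)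
    calc ‖∑ m ∈ s, (A (lp.single 2 m (diagOp L hf φ m))) n‖
        ≤ ∑ m ∈ s, B * (|f m| * ‖φ m‖) := by
          refine (norm_sum_le _ _).trans (Finset.sum_le_sum fun m _ => ?_)
          by_cases hm : f m = 0
          · rw [diagOp_apply, hm]
            simp
          · refine (hA n m hn hm _).trans (le_of_eq ?_)
            rw [diagOp_apply, norm_smul, Complex.norm_real, Real.norm_eq_abs]
      _ = B * ∑ m ∈ s, |f m| * ‖φ m‖ := (Finset.mul_sum _ _ _).symm
      _ ≤ B * (√S * ‖φ‖) := by
          gcongr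
          refine (Real.sum_mul_le_sqrt_mul_sqrt s _ _).trans ?_
          simp only [sq_abs]
          refine mul_le_mul (Real.sqrt_le_sqrt (hS s)) ?_ (Real.sqrt_nonneg _) (Real.sqrt_nonneg _)
          exact Real.sqrt_le_iff.2 ⟨norm_nonneg _, hφ s⟩
  have hfin : B * S * ‖φ‖ = √S * K := by
    rw [hK]
    linear_combination (-B * ‖φ‖) * Real.mul_self_sqrt hS0
  rw [hfin]
  refine lp.norm_le_of_forall_sum_le (by norm_num) (by positivity) fun s => ?_
  rw [htwo, Real.rpow_two, mul_pow, Real.sq_sqrt hS0]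
  calc ∑ n ∈ s, ‖(diagOp L hf * A * diagOp L hf) φ n‖ ^ (2 : ℝ)
      ≤ ∑ n ∈ s, f n ^ 2 * K ^ 2 := by
        refine Finset.sum_le_sum fun n _ => ?_
        have : (diagOp L hf * A * diagOp L hf) φ n = ((f n : ℝ) : ℂ) • (A (diagOp L hf φ)) n := rfl
        rw [this, norm_smul, Complex.norm_real, Real.rpow_two, mul_pow, Real.norm_eq_abs, sq_abs]
        by_cases hn : f n = 0
        · simp [hn]
        · have := hpt n hn
          gcongr
    _ = (∑ n ∈ s, f n ^ 2) * K ^ 2 := (Finset.sum_mul _ _ _).symm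
    _ ≤ S * K ^ 2 := by
        have := hS s
        gcongr

end DiagOp

/-- Weighted decay of a family of contractions whose kernels decay inside a cone. -/
lemma exists_norm_weightOp_mul_mul_weightOp_le {α : ℝ≥0} {γ : ℝ} (h1 : γ ≤ (d : ℝ) / 2)
    (h2 : γ < 2 * (α : ℝ) - (d : ℝ) / 2) {U : ℝ → Op d L} (hU : ∀ t, ‖U t‖ ≤ 1) {C c : ℝ}
    (hC : 0 ≤ C) (hc : 0 < c)
    (hker : ∀ (t : ℝ) (n m : Fin d → ℤ) (v : Fibre L), 1 ≤ t → latticeNorm (n - m) ≤ c * t →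
      ‖(U t (lp.single 2 m v)) n‖ ≤ C * t ^ (-(d : ℝ) / 2) * ‖v‖) :
    ∃ C', ∀ t, 1 ≤ t → ‖weightOp d L α * U t * weightOp d L α‖ ≤ C' * t ^ (-γ) := by
  -- Chosen so that `-d/2 + 2δ = -γ`. The summability condition `α + δ > d/2` then reads `γ < 2α -
  -- d/2`.
  set δ := ((d : ℝ) / 2 - γ) / 2 with hδ
  have hδ0 : 0 ≤ δ := by rw [hδ]; linarith
  have hsum := summable_one_add_latticeNorm_sq_rpow (d := d) (s := α + δ) (by rw [hδ]; linarith)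
  set Z := ∑' n : Fin d → ℤ, (1 + latticeNorm n ^ 2) ^ (-((α : ℝ) + δ)) with hZ
  have hZ0 : 0 ≤ Z := tsum_nonneg fun n => by positivity
  refine ⟨C * ((1 + (c / 2) ^ 2) ^ δ * Z) + 2 * (c / 2) ^ (-(α : ℝ)), fun t ht => ?_⟩
  have ht0 : 0 < t := by linarith
  -- Two sites within distance `ct/2` of the origin differ by at most `ct`, hence lie in the cone of
  -- the kernel bound.
  set r := c * t / 2 with hr
  have hr0 : 0 < r := by positivity
  let f₁ : (Fin d → ℤ) → ℝ := fun n => if latticeNorm n ≤ r then weight α n else 0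
  let f₂ : (Fin d → ℤ) → ℝ := fun n => if latticeNorm n ≤ r then 0 else weight α n
  have hf₁ : ∀ n, |f₁ n| ≤ 1 := fun n => by
    simp only [f₁]
    split_ifs
    · rw [abs_of_nonneg (weight_nonneg _ _)]
      exact weight_le_one _ _
    · simp
  have hf₂ : ∀ n, |f₂ n| ≤ r ^ (-(α : ℝ)) := fun n => by
    simp only [f₂]
    split_ifs with h
    · rw [abs_zero]
      positivity
    · rw [abs_of_nonneg (weight_nonneg _ _), weight_eq, show -(α : ℝ) = 2 * (-(α : ℝ) / 2) by ring,
        Real.rpow_mul hr0.le, Real.rpow_two, show 2 * (-(α : ℝ) / 2) / 2 = -(α : ℝ) / 2 by ring]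
      refine Real.rpow_le_rpow_of_nonpos (by positivity) ?_ (by linarith [α.2])
      have : r ^ 2 ≤ latticeNorm n ^ 2 := pow_le_pow_left₀ hr0.le (not_le.1 h).le 2
      linarith
  set W := weightOp d L α with hW
  set W₁ : Op d L := diagOp L hf₁ with hW₁
  set W₂ : Op d L := diagOp L hf₂ with hW₂
  have hadd : W = W₁ + W₂ := by
    ext φ n : 3
    have e : (f₁ n : ℂ) + (f₂ n : ℂ) = (weight α n : ℂ) := by
      simp only [f₁, f₂]
      split_ifs <;> simp
    change ((weight α n : ℝ) : ℂ) • φ n = (f₁ n : ℂ) • φ n + (f₂ n : ℂ) • φ n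
    rw [← add_smul, e]
  -- Each term after the main one contains `W₂`, of norm `O(t^{-α})`; adding the two conditions on
  -- `γ` gives `γ < α`.
  have hdec : W * U t * W = W₁ * U t * W₁ + (W₂ * U t * W + W₁ * U t * W₂) := by
    rw [hadd]
    noncomm_ring
  have hW1 : ‖W₁‖ ≤ 1 := norm_diagOp_le hf₁
  have hWn : ‖W‖ ≤ 1 := LinearMap.mkContinuous_norm_le _ zero_le_one _
  have hW2 : ‖W₂‖ ≤ r ^ (-(α : ℝ)) := norm_diagOp_le hf₂
  have hmain : ‖W₁ * U t * W₁‖ ≤ (C * t ^ (-(d : ℝ) / 2)) * ((1 + r ^ 2) ^ δ * Z) := by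
    refine norm_diagOp_mul_mul_diagOp_le hf₁ (by positivity) (fun n m hn hm v => ?_) fun s => ?_
    · have hn' : latticeNorm n ≤ r := by
        by_contra h
        exact hn (if_neg h)
      have hm' : latticeNorm m ≤ r := by
        by_contra h
        exact hm (if_neg h)
      refine hker t n m v ht ((latticeNorm_sub_le n m).trans ?_)
      rw [hr] at hn' hm'
      linarith
    · calc ∑ n ∈ s, f₁ n ^ 2
          ≤ ∑ n ∈ s, (1 + r ^ 2) ^ δ * (1 + latticeNorm n ^ 2) ^ (-((α : ℝ) + δ)) := by
            refine Finset.sum_le_sum fun n _ => ?_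
            simp only [f₁]
            split_ifs with h
            -- The squared weight is `(1+|n|²)^δ (1+|n|²)^{-(α+δ)}`: the first factor is at most its
            -- value at radius `r`, the second is summable.
            · have hp : 0 < 1 + latticeNorm n ^ 2 := by positivity
              rw [weight_eq, ← Real.rpow_natCast, ← Real.rpow_mul hp.le]
              have e : -(α : ℝ) / 2 * ((2 : ℕ) : ℝ) = δ + -((α : ℝ) + δ) := by
                push_cast
                ring
              rw [e, Real.rpow_add hp]
              have := latticeNorm_nonneg n
              gcongr
            · rw [zero_pow two_ne_zero]
              positivity
        _ = (1 + r ^ 2) ^ δ * ∑ n ∈ s, (1 + latticeNorm n ^ 2) ^ (-((α : ℝ) + δ)) :=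
            (Finset.mul_sum _ _ _).symm
        _ ≤ (1 + r ^ 2) ^ δ * Z := by
            gcongr
            exact hsum.sum_le_tsum s fun n _ => by positivity
  have hr2 : (1 + r ^ 2) ^ δ ≤ (1 + (c / 2) ^ 2) ^ δ * t ^ (2 * δ) := by
    rw [Real.rpow_mul ht0.le, Real.rpow_two, ← Real.mul_rpow (by positivity) (by positivity)]
    refine Real.rpow_le_rpow (by positivity) ?_ hδ0
    rw [hr]
    nlinarith [one_le_pow₀ ht (n := 2)]
  have htm : t ^ (-(d : ℝ) / 2) * t ^ (2 * δ) = t ^ (-γ) := by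
    rw [← Real.rpow_add ht0]
    congr 1
    rw [hδ]
    ring
  have hmain' : ‖W₁ * U t * W₁‖ ≤ C * ((1 + (c / 2) ^ 2) ^ δ * Z) * t ^ (-γ) := by
    refine hmain.trans ?_
    calc C * t ^ (-(d : ℝ) / 2) * ((1 + r ^ 2) ^ δ * Z)
        ≤ C * t ^ (-(d : ℝ) / 2) * ((1 + (c / 2) ^ 2) ^ δ * t ^ (2 * δ) * Z) := by gcongr
      _ = C * ((1 + (c / 2) ^ 2) ^ δ * Z) * (t ^ (-(d : ℝ) / 2) * t ^ (2 * δ)) := by ring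
      _ = _ := by rw [htm]
  have hra : r ^ (-(α : ℝ)) ≤ (c / 2) ^ (-(α : ℝ)) * t ^ (-γ) := by
    rw [hr, show c * t / 2 = c / 2 * t by ring, Real.mul_rpow (by positivity) ht0.le]
    gcongr 2
    linarith
  have hmul : ∀ A B D : Op d L, ‖A * B * D‖ ≤ ‖A‖ * ‖B‖ * ‖D‖ := fun A B D =>
    (norm_mul_le _ _).trans (mul_le_mul_of_nonneg_right (norm_mul_le _ _) (norm_nonneg _))
  have hb1 : ‖W₂ * U t * W‖ ≤ r ^ (-(α : ℝ)) := by
    calc _ ≤ ‖W₂‖ * ‖U t‖ * ‖W‖ := hmul _ _ _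
      _ ≤ r ^ (-(α : ℝ)) * 1 * 1 := by
        have := hU t
        gcongr
      _ = _ := by ring
  have hb2 : ‖W₁ * U t * W₂‖ ≤ r ^ (-(α : ℝ)) := by
    calc _ ≤ ‖W₁‖ * ‖U t‖ * ‖W₂‖ := hmul _ _ _
      _ ≤ 1 * 1 * r ^ (-(α : ℝ)) := by
        have := hU t
        gcongr
      _ = _ := by ring
  rw [hdec]
  calc _ ≤ ‖W₁ * U t * W₁‖ + (‖W₂ * U t * W‖ + ‖W₁ * U t * W₂‖) :=
        (norm_add_le _ _).trans (by gcongr; exact norm_add_le _ _)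
    _ ≤ _ := by
        rw [add_mul]
        nlinarith

end BlochLAP

end

/-! ### The resolvent as a Laplace transform, and its boundary values. -/

noncomputable section

namespace BlochLAP

open MeasureTheory Set
open scoped ContDiff

variable {d L : ℕ}

lemma isSelfAdjoint_weightOp (α : ℝ≥0) : IsSelfAdjoint (weightOp d L α) := by
  rw [ContinuousLinearMap.isSelfAdjoint_iff_isSymmetric]
  intro φ ψ
  change inner ℂ (weightOp d L α φ) ψ = inner ℂ φ (weightOp d L α ψ)
  rw [lp.inner_eq_tsum, lp.inner_eq_tsum]
  refine tsum_congr fun n => ?_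
  rw [weightOp_apply, weightOp_apply, inner_smul_left, inner_smul_right, Complex.conj_ofReal]

lemma norm_weightOp_le_one (α : ℝ≥0) : ‖weightOp d L α‖ ≤ 1 :=
  LinearMap.mkContinuous_norm_le _ zero_le_one _

section Propagator

variable {H : Op d L}

lemma hasDerivAt_propagator (t : ℝ) :
    HasDerivAt (propagator H) (-Complex.I • (H * propagator H t)) t := by
  rw [← smul_mul_assoc]
  exact hasDerivAt_exp_smul_const' (-Complex.I • H) t

lemma propagator_commute (t : ℝ) : H * propagator H t = propagator H t * H := by
  have h1 : HasDerivAt (propagator H) (propagator H t * (-Complex.I • H)) t :=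
    hasDerivAt_exp_smul_const (-Complex.I • H) t
  have h2 := (hasDerivAt_propagator (H := H) t).unique h1
  rw [mul_smul_comm] at h2
  exact (smul_right_injective _ (neg_ne_zero.2 Complex.I_ne_zero)) h2

lemma continuous_propagator : Continuous (propagator H) :=
  continuous_iff_continuousAt.2 fun t => (hasDerivAt_propagator t).continuousAt

lemma norm_exp_I_mul_mul (t : ℝ) (z : ℂ) :
    ‖Complex.exp (Complex.I * t * z)‖ = Real.exp (-z.im * t) := by
  rw [Complex.norm_exp]
  congr 1
  simp
  ring

/-- The resolvent in the upper half plane is the Laplace transform of the propagator. -/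
lemma resolventOp_eq_integral (hS : IsSelfAdjoint H) {z : ℂ} (hz : 0 < z.im) :
    IntegrableOn (fun t : ℝ => Complex.exp (Complex.I * t * z) • propagator H t) (Ioi 0) ∧
    resolventOp H z =
      Complex.I • ∫ t in Ioi (0 : ℝ), Complex.exp (Complex.I * t * z) • propagator H t := by
  set G : ℝ → Op d L := fun t => Complex.exp (Complex.I * t * z) • propagator H t with hG
  have hGn : ∀ t, ‖G t‖ ≤ Real.exp (-z.im * t) := fun t => by
    rw [hG]
    simp only [norm_smul, norm_exp_I_mul_mul]
    exact mul_le_of_le_one_right (Real.exp_pos _).le (norm_propagator_le_one hS t)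
  have hexp : Continuous fun t : ℝ => Complex.exp (Complex.I * t * z) := by fun_prop
  have hcont : Continuous G := hexp.smul continuous_propagator
  have hGi : IntegrableOn G (Ioi 0) :=
    (exp_neg_integrableOn_Ioi 0 hz).mono' hcont.aestronglyMeasurable
      (Eventually.of_forall hGn)
  -- Integrating `G' = -i(H - z)G` from `G 0 = 1` to the limit `0` gives `(H - z)(i∫G) = 1`. Since
  -- `G` commutes with `H - z`, the inverse is two-sided, as `Ring.inverse` demands.
  have hder : ∀ t, HasDerivAt G (-Complex.I • ((H - z • (1 : Op d L)) * G t)) t := by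
    intro t
    have h1 : HasDerivAt (fun t : ℝ => Complex.exp (Complex.I * t * z))
        (Complex.exp (Complex.I * t * z) * (Complex.I * 1 * z)) t :=
      (((hasDerivAt_id t).ofReal_comp.const_mul Complex.I).mul_const z).cexp
    have h2 := h1.smul (hasDerivAt_propagator (H := H) t)
    have h3 : (H - z • (1 : Op d L)) * G t = Complex.exp (Complex.I * t * z) •
        (H * propagator H t) - (z * Complex.exp (Complex.I * t * z)) • propagator H t := by
      simp only [hG, sub_mul, mul_smul_comm, smul_mul_assoc, one_mul]
      module
    rw [h3]
    refine HasDerivAt.congr_deriv h2 ?_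
    module
  have htend : Tendsto G atTop (𝓝 0) := by
    refine squeeze_zero_norm hGn ?_
    have := Real.tendsto_exp_atBot.comp
      ((tendsto_id (α := ℝ)).const_mul_atTop_of_neg (neg_neg_of_pos hz))
    exact this
  have hint : ∫ t in Ioi (0 : ℝ), -Complex.I • ((H - z • (1 : Op d L)) * G t) = 0 - G 0 :=
    integral_Ioi_of_hasDerivAt_of_tendsto' (fun t _ => hder t)
      ((hGi.const_mul' (H - z • (1 : Op d L))).smul (-Complex.I)) htend
  have hG0 : G 0 = 1 := by simp [hG, propagator]
  have hcomm : ∀ t, (H - z • (1 : Op d L)) * G t = G t * (H - z • (1 : Op d L)) := by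
    intro t
    simp only [hG, sub_mul, mul_sub, mul_smul_comm, smul_mul_assoc, one_mul, mul_one,
      propagator_commute]
    module
  refine ⟨hGi, ?_⟩
  have hl : (H - z • (1 : Op d L)) * (Complex.I • ∫ t in Ioi (0 : ℝ), G t) = 1 := by
    rw [integral_smul, integral_const_mul_of_integrable hGi, hG0] at hint
    rw [mul_smul_comm]
    have := congrArg (fun x => -x) hint
    simpa using this
  have hr : (Complex.I • ∫ t in Ioi (0 : ℝ), G t) * (H - z • (1 : Op d L)) = 1 := by
    simp only [hcomm] at hint
    rw [integral_smul, integral_mul_const_of_integrable hGi, hG0] at hint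
    rw [smul_mul_assoc]
    have := congrArg (fun x => -x) hint
    simpa using this
  exact Ring.inverse_unit (⟨_, _, hl, hr⟩ : (Op d L)ˣ)

/-- The Laplace transform formula for the damped resolvent. -/
lemma dampedResolvent_eq_integral (hS : IsSelfAdjoint H) (α : ℝ≥0) {z : ℂ} (hz : 0 < z.im) :
    dampedResolvent H α z = Complex.I • ∫ t in Ioi (0 : ℝ), Complex.exp (Complex.I * t * z) •
      (weightOp d L α * propagator H t * weightOp d L α) := by
  obtain ⟨hi, h⟩ := resolventOp_eq_integral hS hz
  have hi' : IntegrableOn (fun t : ℝ => weightOp d L α *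
      (Complex.exp (Complex.I * t * z) • propagator H t)) (Ioi 0) := hi.const_mul' _
  rw [dampedResolvent, h, mul_smul_comm, smul_mul_assoc, ← integral_const_mul_of_integrable hi,
    ← integral_mul_const_of_integrable hi']
  simp only [mul_smul_comm, smul_mul_assoc]

/-- Transfers results from the upper to the lower half plane. -/
lemma dampedResolvent_conj (hS : IsSelfAdjoint H) (α : ℝ≥0) (z : ℂ) :
    dampedResolvent H α (starRingEnd ℂ z) = star (dampedResolvent H α z) := by
  have h : H - (starRingEnd ℂ z) • (1 : Op d L) = star (H - z • (1 : Op d L)) := by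
    rw [star_sub, star_smul, hS.star_eq, star_one]
    rfl
  rw [dampedResolvent, dampedResolvent, star_mul, star_mul, (isSelfAdjoint_weightOp α).star_eq,
    resolventOp, resolventOp, h, Ring.inverse_star, mul_assoc]

end Propagator

/-- Interpolation: the Lipschitz bound `|x - y|` when this is at most `1`, the trivial bound `2`
otherwise. -/
lemma norm_exp_sub_exp_le {β : ℝ} (hβ : 0 < β) (hβ1 : β ≤ 1) (x y : ℝ) :
    ‖Complex.exp (Complex.I * x) - Complex.exp (Complex.I * y)‖ ≤ 2 * |x - y| ^ β := by
  have hn : ∀ x : ℝ, ‖Complex.exp (Complex.I * x)‖ = 1 := fun x => by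
    rw [mul_comm, Complex.norm_exp_ofReal_mul_I]
  have h1 : ‖Complex.exp (Complex.I * x) - Complex.exp (Complex.I * y)‖ ≤ |x - y| := by
    have : Complex.exp (Complex.I * x) - Complex.exp (Complex.I * y) =
        Complex.exp (Complex.I * y) * (Complex.exp (Complex.I * ((x - y : ℝ) : ℂ)) - 1) := by
      rw [mul_sub, ← Complex.exp_add, mul_one]
      congr 2
      push_cast
      ring
    rw [this, norm_mul, hn, one_mul]
    exact Real.norm_exp_I_mul_ofReal_sub_one_le
  have h0 : 0 ≤ |x - y| := abs_nonneg _
  obtain h | h := le_total |x - y| 1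
  · refine h1.trans ?_
    have : |x - y| ≤ |x - y| ^ β := by
      simpa using Real.rpow_le_rpow_of_exponent_ge' h0 h hβ.le hβ1
    linarith [Real.rpow_nonneg h0 β]
  · refine (norm_sub_le _ _).trans ?_
    rw [hn, hn]
    linarith [Real.one_le_rpow h hβ.le]

lemma integrableOn_one_add_rpow {γ : ℝ} (hγ : 1 < γ) :
    IntegrableOn (fun t : ℝ => (1 + t) ^ (-γ)) (Ioi 0) := by
  have h := integrableOn_add_rpow_Ioi_of_lt (a := -γ) (c := 0) (m := 1) (by linarith) (by norm_num)
  simpa only [add_comm] using h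

section FourierLaplace

variable {E : Type*} [NormedAddCommGroup E] [NormedSpace ℂ E] {V : ℝ → E} {C γ : ℝ}

/-- Boundary values of the Laplace transform of an integrable function. -/
lemma tendsto_integral_exp_smul (hV : Continuous V) (hγ : 1 < γ)
    (hVb : ∀ t, 0 ≤ t → ‖V t‖ ≤ C * (1 + t) ^ (-γ)) (x : ℝ) :
    Tendsto (fun ε : ℝ => ∫ t in Ioi (0 : ℝ),
        Complex.exp (Complex.I * t * ((x : ℂ) + Complex.I * ε)) • V t) (𝓝[>] 0)
      (𝓝 (∫ t in Ioi (0 : ℝ), Complex.exp (Complex.I * ((t * x : ℝ) : ℂ)) • V t)) := by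
  refine tendsto_integral_filter_of_dominated_convergence (fun t => C * (1 + t) ^ (-γ)) ?_ ?_
    ((integrableOn_one_add_rpow hγ).const_mul C) ?_
  · refine Eventually.of_forall fun ε => Continuous.aestronglyMeasurable ?_
    exact Continuous.smul (by fun_prop) hV
  · filter_upwards [self_mem_nhdsWithin] with ε hε
    refine (ae_restrict_iff' measurableSet_Ioi).2 (Eventually.of_forall fun t ht => ?_)
    have ht0 : 0 < t := ht
    have hε0 : 0 < ε := hε
    rw [norm_smul, norm_exp_I_mul_mul]
    refine (mul_le_of_le_one_left (norm_nonneg _) (Real.exp_le_one_iff.2 ?_)).trans (hVb t ht0.le)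
    simp
    positivity
  · refine Eventually.of_forall fun t => ?_
    have hc : Continuous fun ε : ℝ =>
        Complex.exp (Complex.I * t * ((x : ℂ) + Complex.I * ε)) • V t :=
      Continuous.smul (by fun_prop) continuous_const
    have h := (hc.tendsto 0).mono_left (nhdsWithin_le_nhds (s := Ioi 0))
    convert h using 3
    push_cast
    simp [mul_assoc]

/-- Hölder continuity of the one-sided Fourier transform of a decaying function. -/
lemma norm_integral_exp_smul_sub_le (hV : Continuous V)
    (hVb : ∀ t, 0 ≤ t → ‖V t‖ ≤ C * (1 + t) ^ (-γ)) {β : ℝ} (hβ : 0 < β) (hβ1 : β ≤ 1)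
    (hβγ : β + 1 < γ) (x y : ℝ) :
    ‖(∫ t in Ioi (0 : ℝ), Complex.exp (Complex.I * ((t * x : ℝ) : ℂ)) • V t) -
        ∫ t in Ioi (0 : ℝ), Complex.exp (Complex.I * ((t * y : ℝ) : ℂ)) • V t‖ ≤
      (2 * C * ∫ t in Ioi (0 : ℝ), (1 + t) ^ (-(γ - β))) * |x - y| ^ β := by
  have hint : ∀ x : ℝ, IntegrableOn
      (fun t : ℝ => Complex.exp (Complex.I * ((t * x : ℝ) : ℂ)) • V t) (Ioi 0) := by
    intro x
    refine ((integrableOn_one_add_rpow (γ := γ) (by linarith)).const_mul C).mono'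
      (Continuous.aestronglyMeasurable (Continuous.smul (by fun_prop) hV)) ?_
    refine (ae_restrict_iff' measurableSet_Ioi).2 (Eventually.of_forall fun t ht => ?_)
    rw [norm_smul, mul_comm Complex.I, Complex.norm_exp_ofReal_mul_I, one_mul]
    exact hVb t (le_of_lt ht)
  have hC : 0 ≤ C := by simpa using (norm_nonneg _).trans (hVb 0 le_rfl)
  rw [← integral_sub (hint x) (hint y), mul_assoc, mul_comm (∫ t in Ioi (0 : ℝ), _), ← mul_assoc,
    ← integral_const_mul]
  refine norm_integral_le_of_norm_le
    ((integrableOn_one_add_rpow (γ := γ - β) (by linarith)).const_mul _) ?_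
  refine (ae_restrict_iff' measurableSet_Ioi).2 (Eventually.of_forall fun t ht => ?_)
  have ht0 : 0 < t := ht
  rw [← sub_smul, norm_smul]
  -- The Hölder factor costs `t^β` of the decay, leaving the exponent `γ - β > 1`, which is still
  -- integrable.
  calc _ ≤ (2 * |t * x - t * y| ^ β) * (C * (1 + t) ^ (-γ)) :=
        mul_le_mul (norm_exp_sub_exp_le hβ hβ1 _ _) (hVb t ht0.le) (norm_nonneg _) (by positivity)
    _ = 2 * C * |x - y| ^ β * (t ^ β * (1 + t) ^ (-γ)) := by
        rw [← mul_sub, abs_mul, abs_of_pos ht0, Real.mul_rpow ht0.le (abs_nonneg _)]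
        ring
    _ ≤ 2 * C * |x - y| ^ β * ((1 + t) ^ β * (1 + t) ^ (-γ)) := by
        gcongr
        linarith
    _ = _ := by
        rw [← Real.rpow_add (by linarith)]
        congr 2
        ring

end FourierLaplace

/-- The decay of the weighted propagator, from time zero on. -/
lemma exists_norm_weightOp_propagator_le {H : Op d L} {ℰ : Momentum d → Matrix (Fin L) (Fin L) ℂ}
    (hS : IsSelfAdjoint H) (hT : TranslationInvariant H) (hH : IsSymbol H ℰ)
    (hE : IsAnalyticSymbol ℰ) (hW : degeneracySet ℰ = ∅) (hM : AllBandsMorse ℰ) {α : ℝ≥0} {γ : ℝ}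
    (hγ : 0 ≤ γ) (h1 : γ ≤ (d : ℝ) / 2) (h2 : γ < 2 * (α : ℝ) - (d : ℝ) / 2) :
    ∃ C, ∀ t, 0 ≤ t →
      ‖weightOp d L α * propagator H t * weightOp d L α‖ ≤ C * (1 + t) ^ (-γ) := by
  obtain ⟨C, c, hC, hc, hker⟩ := exists_norm_propagator_single_le hS hT hH hE hW hM
  obtain ⟨C', h⟩ := exists_norm_weightOp_mul_mul_weightOp_le h1 h2 (norm_propagator_le_one hS)
    hC hc hker
  -- The factor `2 ^ γ` absorbs `1 + t ≤ 2` for `t ≤ 1`, where the norm is at most `1`, and `1 + t ≤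
  -- 2t` for `t ≥ 1`.
  refine ⟨2 ^ γ * max C' 1, fun t ht => ?_⟩
  obtain ht1 | ht1 := le_total t 1
  · calc _ ≤ ‖weightOp d L α‖ * ‖propagator H t‖ * ‖weightOp d L α‖ :=
          (norm_mul_le _ _).trans (mul_le_mul_of_nonneg_right (norm_mul_le _ _) (norm_nonneg _))
      _ ≤ 1 * 1 * 1 := by
          have h1 := norm_weightOp_le_one (d := d) (L := L) α
          have h2 := norm_propagator_le_one hS t
          gcongr
      _ = 2 ^ γ * 1 * 2 ^ (-γ) := by
          rw [mul_one (2 ^ γ : ℝ), ← Real.rpow_add two_pos]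
          simp
      _ ≤ _ := by
          gcongr ?_ * ?_ * ?_
          · exact le_max_right _ _
          · exact Real.rpow_le_rpow_of_nonpos (by linarith) (by linarith) (by linarith)
  · have ht0 : 0 < t := by linarith
    calc _ ≤ C' * t ^ (-γ) := h t ht1
      _ ≤ max C' 1 * t ^ (-γ) := by
          gcongr
          exact le_max_left _ _
      _ = 2 ^ γ * max C' 1 * (2 * t) ^ (-γ) := by
          have : (2 : ℝ) ^ γ * 2 ^ (-γ) = 1 := by
            rw [← Real.rpow_add two_pos]
            simp
          rw [Real.mul_rpow two_pos.le ht0.le]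
          linear_combination (-(max C' 1) * t ^ (-γ)) * this
      _ ≤ _ := by
          have hm : (0 : ℝ) ≤ max C' 1 := le_max_of_le_right zero_le_one
          gcongr 2 ^ γ * max C' 1 * ?_
          exact Real.rpow_le_rpow_of_nonpos (by linarith) (by linarith) (by linarith)

/-- Limiting absorption from the upper half plane. -/
theorem exists_boundary_values (hd : 3 ≤ d) {H : Op d L}
    {ℰ : Momentum d → Matrix (Fin L) (Fin L) ℂ} (hS : IsSelfAdjoint H)
    (hT : TranslationInvariant H) (hH : IsSymbol H ℰ) (hE : IsAnalyticSymbol ℰ)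
    (hW : degeneracySet ℰ = ∅) (hM : AllBandsMorse ℰ) {α : ℝ≥0}
    (hα : ((d : ℝ) + 2) / 4 < (α : ℝ)) :
    ∃ R : ℝ → Op d L,
      (∀ E : ℝ, Tendsto (fun ε : ℝ => dampedResolvent H α ((E : ℂ) + Complex.I * (ε : ℂ)))
        (𝓝[>] 0) (𝓝 (R E))) ∧
      ∀ β : ℝ, 0 < β → β < 2 * (α : ℝ) - ((d : ℝ) + 2) / 2 → β < ((d : ℝ) - 2) / 2 → β ≤ 1 →
        ∃ C : ℝ, ∀ E E' : ℝ, ‖R E - R E'‖ ≤ C * |E - E'| ^ β := by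
  have hd' : (3 : ℝ) ≤ d := by exact_mod_cast hd
  set V : ℝ → Op d L := fun t => weightOp d L α * propagator H t * weightOp d L α with hV
  have hVc : Continuous V :=
    (continuous_const.mul continuous_propagator).mul continuous_const
  refine ⟨fun E => Complex.I • ∫ t in Ioi (0 : ℝ),
    Complex.exp (Complex.I * ((t * E : ℝ) : ℂ)) • V t, fun E => ?_, fun β hβ h1 h2 h3 => ?_⟩
  -- Here `1 < d/2` is `d ≥ 3`, and `1 < 2α - d/2` is `α > (d+2)/4`.
  · obtain ⟨γ, hγ1, hγ2⟩ : ∃ γ : ℝ, 1 < γ ∧ γ < min ((d : ℝ) / 2) (2 * (α : ℝ) - (d : ℝ) / 2) :=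
      exists_between (lt_min (by linarith) (by linarith))
    obtain ⟨C, hC⟩ := exists_norm_weightOp_propagator_le hS hT hH hE hW hM (by linarith : 0 ≤ γ)
      (hγ2.trans_le (min_le_left _ _)).le (hγ2.trans_le (min_le_right _ _))
    refine ((tendsto_integral_exp_smul hVc hγ1 hC E).const_smul Complex.I).congr' ?_
    filter_upwards [self_mem_nhdsWithin] with ε hε
    exact (dampedResolvent_eq_integral hS α (by simpa using! hε)).symm
  -- The conditions `β + 1 < d/2` and `β + 1 < 2α - d/2` are the bounds `h2` and `h1` on `β`.
  · obtain ⟨γ, hγ1, hγ2⟩ : ∃ γ : ℝ, β + 1 < γ ∧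
        γ < min ((d : ℝ) / 2) (2 * (α : ℝ) - (d : ℝ) / 2) :=
      exists_between (lt_min (by linarith) (by linarith))
    obtain ⟨C, hC⟩ := exists_norm_weightOp_propagator_le hS hT hH hE hW hM (by linarith : 0 ≤ γ)
      (hγ2.trans_le (min_le_left _ _)).le (hγ2.trans_le (min_le_right _ _))
    refine ⟨2 * C * ∫ t in Ioi (0 : ℝ), (1 + t) ^ (-(γ - β)), fun E E' => ?_⟩
    rw [← smul_sub, norm_smul, Complex.norm_I, one_mul]
    exact norm_integral_exp_smul_sub_le hVc hC hβ h3 hγ1 E E'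

end BlochLAP

end

/-! ### The theorem for both signs. -/

theorem mainTheorem2 (d L : ℕ) (hd : 3 ≤ d)
    (H : BlochLAP.Op d L) (hH : IsSelfAdjoint H) (hT : BlochLAP.TranslationInvariant H)
    (ℰ : BlochLAP.Momentum d → Matrix (Fin L) (Fin L) ℂ)
    (hsymb : BlochLAP.IsSymbol H ℰ) (hanalytic : BlochLAP.IsAnalyticSymbol ℰ)
    (hW : BlochLAP.degeneracySet ℰ = ∅) (hMorse : BlochLAP.AllBandsMorse ℰ)
    (α : ℝ≥0) (hα : ((d : ℝ) + 2) / 4 < (α : ℝ))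
    (σ : ℝ) (hσ : σ = 1 ∨ σ = -1) :
    ∃ R : ℝ → BlochLAP.Op d L,
      (∀ E : ℝ,
        Tendsto
          (fun ε : ℝ => BlochLAP.dampedResolvent H α ((E : ℂ) + (σ : ℂ) * Complex.I * (ε : ℂ)))
          (𝓝[>] 0) (𝓝 (R E))) ∧
      ∀ β : ℝ, 0 < β →
        β < min (min (2 * (α : ℝ) - ((d : ℝ) + 2) / 2) (((d : ℝ) - 2) / 2))
              (min ((α : ℝ) - 1) 1) →
        ∃ C : ℝ, ∀ E E' : ℝ, ‖R E - R E'‖ ≤ C * |E - E'| ^ β := by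
  obtain ⟨R, hlim, hhol⟩ := BlochLAP.exists_boundary_values hd hH hT hsymb hanalytic hW hMorse hα
  have hhol' : ∀ β : ℝ, 0 < β →
      β < min (min (2 * (α : ℝ) - ((d : ℝ) + 2) / 2) (((d : ℝ) - 2) / 2)) (min ((α : ℝ) - 1) 1) →
      ∃ C : ℝ, ∀ E E' : ℝ, ‖R E - R E'‖ ≤ C * |E - E'| ^ β := by
    intro β hβ h
    simp only [lt_min_iff] at h
    exact hhol β hβ h.1.1 h.1.2 h.2.2.le
  rcases hσ with rfl | rfl
  · refine ⟨R, fun E => ?_, hhol'⟩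
    simpa using hlim E
  -- The boundary values from below are the adjoints of those from above; taking adjoints is
  -- isometric, so the Hölder constant is unchanged.
  · refine ⟨fun E => star (R E), fun E => ?_, fun β hβ h => ?_⟩
    · refine ((continuous_star.tendsto _).comp (hlim E)).congr fun ε => ?_
      rw [Function.comp_apply, ← BlochLAP.dampedResolvent_conj hH]
      congr 1
      simp
    · obtain ⟨C, hC⟩ := hhol' β hβ h
      refine ⟨C, fun E E' => ?_⟩
      rw [← star_sub, norm_star]
      exact hC E E'
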